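/- Let $k,l$ be integers with $1\le k\le l+1$ and $k\ne l+1$, let $p=l-k+1$ (so $p\ge 1$), and let $f,g$ be real functions analytic at $0$ with $f(0)\neq 0$. Put $F=g/f$ and consider the planar system $$\dot z=-w f(z)+z^{l+1}g(z),\qquad \dot w=k z^{2k-1}f(z)+k\,w\,z^{l}g(z),$$ with the transversal $\mathcal T:\ f(z)\,w=z^{l+1}g(z)$, $z>0$. Write $$\theta_p=(-1)^{p+k-1},\quad B_0=2(p+2k)F(0),\quad B_1=2(p+2k+1)F'(0),\quad \Phi_{p,k}(\xi)=\xi^{-2}\int_{1-\xi^2}^1 s^{p+k-1}(1-s^{2k})^{1/2}\,ds .$$ (a) There is a function $Z$, real analytic at $0$, with the following property. For every neighborhood $U$ of the origin and every sufficiently small $\epsilon>0$, the solution that starts on $\mathcal T$ at the point with $z=\epsilon$, followed counterclockwise (that is, forward in time if $f(0)>0$, and backward in time if $f(0)<0$), exists and stays in $U$ until its first return to $\mathcal T$, and this return takes place at the point with $z=Z(\epsilon)$. The Taylor expansion at $0$ is $$Z(\epsilon)=\epsilon+\sum_{n\ge p+1}Z_n\epsilon^n,\qquad Z_{p+1}=2\,\frac{B_0\Phi_{p,k}(1)}{2k}\,(1+\theta_p).$$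 If $p\ge 2$, then $$Z_{p+2}=2\,\frac{B_1\Phi_{p+1,k}(1)}{2k}\,(1-\theta_p),$$ and if $p=1$, then $$Z_{3}=2\left[\frac{(1-\theta_1)B_1\Phi_{2,k}(1)+\frac{1+\theta_1}{k}B_0^2\,\Phi_{1,k}(1)^2}{2k}+\left(\frac{B_0\Phi_{1,k}(1)}{2k}(1+\theta_1)\right)^2\right].$$ (b) If the origin is a center of the system (every point other than the origin of some neighborhood of it lies on a nonconstant periodic solution), then $F'(0)=0$ when $p+k-1$ is odd, and $F(0)=0$ when $p+k-1$ is even. -/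

import Mathlib

open Set Filter Topology

noncomputable section

/-- The planar vector field
`ż = -w f(z) + z^(l+1) g(z)`, `ẇ = k z^(2k-1) f(z) + k w z^l g(z)`; points are pairs `(z, w)`. -/
def nilpotentField (f g : ℝ → ℝ) (k l : ℕ) (q : ℝ × ℝ) : ℝ × ℝ :=
  (-q.2 * f q.1 + q.1 ^ (l + 1) * g q.1,
    k * q.1 ^ (2 * k - 1) * f q.1 + k * q.2 * q.1 ^ l * g q.1)

/-- The transversal `f(z) w = z^(l+1) g(z)`, `z > 0`. -/
def transversal (f g : ℝ → ℝ) (l : ℕ) : Set (ℝ × ℝ) :=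
  {q | 0 < q.1 ∧ f q.1 * q.2 = q.1 ^ (l + 1) * g q.1}

/-- The field with time oriented so that small orbits turn counterclockwise around the origin:
the field itself if `f(0) > 0`, its time reversal if `f(0) < 0`. -/
def orientedField (f g : ℝ → ℝ) (k l : ℕ) (q : ℝ × ℝ) : ℝ × ℝ :=
  (SignType.sign (f 0) : ℝ) • nilpotentField f g k l q

/-- The solution of `q̇ = v q` that starts on `S` with first coordinate `a` exists and stays in `U`
until it meets `S` again for the first time, at a point with first coordinate `b`. -/
def FirstReturn (v : ℝ × ℝ → ℝ × ℝ) (S U : Set (ℝ × ℝ)) (a b : ℝ) : Prop :=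
  ∃ (γ : ℝ → ℝ × ℝ) (T : ℝ), 0 < T ∧ IsIntegralCurveOn γ (fun _ => v) (Icc 0 T) ∧
    (∀ t ∈ Icc 0 T, γ t ∈ U) ∧
    γ 0 ∈ S ∧ (γ 0).1 = a ∧
    γ T ∈ S ∧ (γ T).1 = b ∧
    ∀ t ∈ Ioo 0 T, γ t ∉ S

/-- The origin is a center of `v`: it is an equilibrium, and every other point of some
neighborhood of it lies on a nonconstant periodic solution. -/
def IsCenterAtOrigin (v : ℝ × ℝ → ℝ × ℝ) : Prop :=
  v (0, 0) = 0 ∧ ∃ U ∈ 𝓝 ((0, 0) : ℝ × ℝ), ∀ q ∈ U, q ≠ (0, 0) →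
    ∃ (γ : ℝ → ℝ × ℝ) (T : ℝ), 0 < T ∧ IsIntegralCurve γ (fun _ => v) ∧
      γ 0 = q ∧ Function.Periodic γ T ∧ ∃ t, γ t ≠ q

/-- `F = g / f`. -/
def quotF (f g : ℝ → ℝ) (z : ℝ) : ℝ := g z / f z

/-- `Φ_{p,k}(ξ) = ξ⁻² ∫_{1-ξ²}^1 s^(p+k-1) (1 - s^(2k))^(1/2) ds`. -/
def PhiInt (p k : ℕ) (ξ : ℝ) : ℝ :=
  (ξ ^ 2)⁻¹ * ∫ s in (1 - ξ ^ 2)..1, s ^ (p + k - 1) * √(1 - s ^ (2 * k))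

/-- `B₀ = 2 (p + 2k) F(0)`. -/
def coefB0 (p k : ℕ) (F : ℝ → ℝ) : ℝ := 2 * (p + 2 * k) * F 0

/-- `B₁ = 2 (p + 2k + 1) F'(0)`. -/
def coefB1 (p k : ℕ) (F : ℝ → ℝ) : ℝ := 2 * (p + 2 * k + 1) * deriv F 0

/-- `θ_p = (-1)^(p+k-1)`. -/
def thetaSign (p k : ℕ) : ℝ := (-1) ^ (p + k - 1)

end

/-! With y = w - z^(l+1) F(z) the system is f(z) times the Liénard system z' = -y, y' = k z^(2k-1) +
z^l M(z) y + k z^(2l+1) F(z)^2, M = (k+l+1) F + z F'. This perturbs the Hamiltonian flow of z^(2k) +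
y^2, and near the origin the transversal is y = 0, z > 0. In weighted polar coordinates z = R X(θ),
y = R^k Y(θ) with X^(2k) + Y^2 = 1, the orbits satisfy an equation dR/dθ = O(R^(p+1)).

Writing R = ε x turns this into x = 1 + ε^p ∫ G(ε, x) in the Banach algebra C[0, 2π], on which F and
M act analytically. The analytic implicit function theorem (`exists_analyticAt_fixedPoint`,
`exists_lifted_solution`) gives x analytic in ε, including at ε = 0. Hence Z = ε + ε^(p+1) η(ε),
where η(ε) is the integral of G over a turn. In the expansion of η to first order, terms in Y^2 X^n
give beta integrals (zero for odd n), terms odd in Y are exact differentials in X, and for p = 1 the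
nested integral gives η(0)^2 (`exists_polar_solution`). `exists_firstReturn` carries this back to
the planar field.

For (b), if the leading coefficient of Z(ε) - ε is negative, iterated returns tend to the origin,
which no periodic orbit can do (`not_isCenterAtOrigin_of_contracting`). The opposite sign reduces to
this one: w ↦ -w with time reversal replaces g by -g. -/

noncomputable section

open Real

/-! ### Generalized trigonometric functions on the curve X^(2k) + Y^2 = 1 -/

/-- `cos^(2k) + sin^2`. -/
def quasiDen (k : ℕ) (θ : ℝ) : ℝ := cos θ ^ (2 * k) + sin θ ^ 2

/-- The radial factor that projects `(cos θ, sin θ)` to the curve `X^(2k) + Y^2 = 1` along the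
weighted rays `(r X, r^k Y)`. -/
def quasiRad (k : ℕ) (θ : ℝ) : ℝ := quasiDen k θ ^ (-(1 / (2 * k : ℝ)))

/-- The first coordinate of a parametrization of `X^(2k) + Y^2 = 1`. -/
def quasiCos (k : ℕ) (θ : ℝ) : ℝ := cos θ * quasiRad k θ

/-- The second coordinate of a parametrization of `X^(2k) + Y^2 = 1`. -/
def quasiSin (k : ℕ) (θ : ℝ) : ℝ := sin θ * quasiRad k θ ^ k

/-- The speed of the parametrization `(quasiCos, quasiSin)` relative to the Hamiltonian flow of
`X^(2k) + Y^2`. -/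
def quasiSpeed (k : ℕ) (θ : ℝ) : ℝ :=
  quasiRad k θ ^ (k + 1) * (cos θ ^ 2 + k * sin θ ^ 2) / k

lemma quasiDen_pos (k : ℕ) (θ : ℝ) : 0 < quasiDen k θ := by
  unfold quasiDen
  rw [pow_mul]
  rcases eq_or_ne (sin θ) 0 with h | h
  · have : cos θ ^ 2 = 1 := by have := sin_sq_add_cos_sq θ; rw [h] at this; linarith
    rw [this, h]; norm_num
  · have : 0 < sin θ ^ 2 := by positivity
    positivity

lemma quasiRad_pos (k : ℕ) (θ : ℝ) : 0 < quasiRad k θ := rpow_pos_of_pos (quasiDen_pos k θ) _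

/-- This normalization lets the identities below be checked polynomially, without real exponents. -/
lemma quasiRad_pow {k : ℕ} (hk : 1 ≤ k) (θ : ℝ) :
    quasiRad k θ ^ (2 * k) * quasiDen k θ = 1 := by
  have hk0 : (k : ℝ) ≠ 0 := by positivity
  rw [quasiRad, ← rpow_natCast, ← rpow_mul (quasiDen_pos k θ).le]
  have : -(1 / (2 * k : ℝ)) * ((2 * k : ℕ) : ℝ) = -1 := by push_cast; field_simp
  rw [this, rpow_neg_one, inv_mul_cancel₀ (quasiDen_pos k θ).ne']

lemma quasiSpeed_pos {k : ℕ} (hk : 1 ≤ k) (θ : ℝ) : 0 < quasiSpeed k θ := by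
  have hk1 : (1 : ℝ) ≤ k := by exact_mod_cast hk
  have h1 : 0 < cos θ ^ 2 + k * sin θ ^ 2 := by
    nlinarith [sin_sq_add_cos_sq θ, sq_nonneg (sin θ)]
  have := quasiRad_pos k θ
  unfold quasiSpeed
  positivity

lemma quasiCos_pow_add_quasiSin_sq {k : ℕ} (hk : 1 ≤ k) (θ : ℝ) :
    quasiCos k θ ^ (2 * k) + quasiSin k θ ^ 2 = 1 := by
  rw [← quasiRad_pow hk θ, quasiCos, quasiSin, quasiDen]
  ring

lemma hasDerivAt_quasiDen (k : ℕ) (θ : ℝ) :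
    HasDerivAt (quasiDen k)
      (2 * k * cos θ ^ (2 * k - 1) * (-sin θ) + 2 * sin θ * cos θ) θ := by
  have := ((hasDerivAt_cos θ).pow (2 * k)).add ((hasDerivAt_sin θ).pow 2)
  refine this.congr_deriv ?_
  push_cast
  ring

lemma hasDerivAt_quasiRad (k : ℕ) (θ : ℝ) :
    HasDerivAt (quasiRad k)
      (-(1 / (2 * k : ℝ)) * quasiRad k θ *
        (2 * k * cos θ ^ (2 * k - 1) * (-sin θ) + 2 * sin θ * cos θ) / quasiDen k θ) θ := by
  have := (hasDerivAt_quasiDen k θ).rpow_const (p := -(1 / (2 * k : ℝ)))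
    (Or.inl (quasiDen_pos k θ).ne')
  refine this.congr_deriv ?_
  rw [rpow_sub_one (quasiDen_pos k θ).ne', quasiRad]
  ring

/-- The point stays on a level curve of X^(2k) + Y^2, so its velocity is a multiple of (-Y, k
X^(2k-1)); `quasiSpeed` is that multiple. Parametrizing by the ordinary angle makes the period
exactly 2π. -/
lemma hasDerivAt_quasiCos {k : ℕ} (hk : 1 ≤ k) (θ : ℝ) :
    HasDerivAt (quasiCos k) (-(quasiSpeed k θ * quasiSin k θ)) θ := by
  have hk0 : (k : ℝ) ≠ 0 := by positivity
  refine ((hasDerivAt_cos θ).mul (hasDerivAt_quasiRad k θ)).congr_deriv ?_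
  have h1 := quasiRad_pow hk θ
  have hD := (quasiDen_pos k θ).ne'
  have h2 : cos θ ^ (2 * k) = cos θ ^ (2 * k - 1) * cos θ := by
    rw [← pow_succ]; congr 1; omega
  have h3 : quasiDen k θ = cos θ ^ (2 * k - 1) * cos θ + sin θ ^ 2 := by rw [quasiDen, h2]
  have h4 : quasiSpeed k θ * quasiSin k θ =
      quasiRad k θ * sin θ * (cos θ ^ 2 + k * sin θ ^ 2) / (k * quasiDen k θ) := by
    rw [eq_div_iff (by positivity), quasiSpeed, quasiSin]
    field_simp
    linear_combination (quasiRad k θ * sin θ * (cos θ ^ 2 + k * sin θ ^ 2)) * h1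
  rw [h4]
  field_simp
  rw [h3]
  ring

lemma hasDerivAt_quasiSin {k : ℕ} (hk : 1 ≤ k) (θ : ℝ) :
    HasDerivAt (quasiSin k) (k * quasiCos k θ ^ (2 * k - 1) * quasiSpeed k θ) θ := by
  have hk0 : (k : ℝ) ≠ 0 := by positivity
  refine ((hasDerivAt_sin θ).mul ((hasDerivAt_quasiRad k θ).pow k)).congr_deriv ?_
  have h1 := quasiRad_pow hk θ
  have hD := (quasiDen_pos k θ).ne'
  have h2 : cos θ ^ (2 * k) = cos θ ^ (2 * k - 1) * cos θ := by
    rw [← pow_succ]; congr 1; omega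
  have h3 : quasiDen k θ = cos θ ^ (2 * k - 1) * cos θ + sin θ ^ 2 := by rw [quasiDen, h2]
  have h5 : quasiRad k θ ^ (2 * k) = quasiRad k θ ^ (2 * k - 1) * quasiRad k θ := by
    rw [← pow_succ]; congr 1; omega
  have h6 : quasiRad k θ ^ k = quasiRad k θ ^ (k - 1) * quasiRad k θ := by
    rw [← pow_succ]; congr 1; omega
  have h4 : k * quasiCos k θ ^ (2 * k - 1) * quasiSpeed k θ =
      quasiRad k θ ^ k * cos θ ^ (2 * k - 1) * (cos θ ^ 2 + k * sin θ ^ 2) / quasiDen k θ := by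
    rw [eq_div_iff (by positivity), quasiSpeed, quasiCos, mul_pow]
    field_simp
    rw [h5] at h1
    linear_combination (quasiRad k θ ^ k * cos θ ^ (2 * k - 1) *
      (cos θ ^ 2 + k * sin θ ^ 2)) * h1
  rw [h4]
  simp only [Pi.pow_apply]
  field_simp
  rw [h3, h6]
  ring

lemma continuous_quasiCos {k : ℕ} (hk : 1 ≤ k) : Continuous (quasiCos k) :=
  continuous_iff_continuousAt.2 fun θ => (hasDerivAt_quasiCos hk θ).continuousAt

lemma continuous_quasiSin {k : ℕ} (hk : 1 ≤ k) : Continuous (quasiSin k) :=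
  continuous_iff_continuousAt.2 fun θ => (hasDerivAt_quasiSin hk θ).continuousAt

lemma continuous_quasiSpeed (k : ℕ) : Continuous (quasiSpeed k) := by
  have : Continuous (quasiRad k) :=
    continuous_iff_continuousAt.2 fun θ => (hasDerivAt_quasiRad k θ).continuousAt
  unfold quasiSpeed
  fun_prop

lemma abs_quasiCos_le_one {k : ℕ} (hk : 1 ≤ k) (θ : ℝ) : |quasiCos k θ| ≤ 1 := by
  have h := quasiCos_pow_add_quasiSin_sq hk θ
  have h1 : quasiCos k θ ^ (2 * k) ≤ 1 := by nlinarith [sq_nonneg (quasiSin k θ)]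
  have h2 : |quasiCos k θ| ^ (2 * k) ≤ 1 := by
    rwa [(even_two_mul k).pow_abs]
  exact (pow_le_one_iff_of_nonneg (abs_nonneg _) (by omega)).1 h2

lemma abs_quasiSin_le_one {k : ℕ} (hk : 1 ≤ k) (θ : ℝ) : |quasiSin k θ| ≤ 1 := by
  have h := quasiCos_pow_add_quasiSin_sq hk θ
  have h1 : 0 ≤ quasiCos k θ ^ (2 * k) := (even_two_mul k).pow_nonneg _
  rw [← sq_le_one_iff_abs_le_one]
  linarith

lemma quasiRad_of_sin_eq_zero {k : ℕ} {θ : ℝ} (h : sin θ = 0) : quasiRad k θ = 1 := by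
  have h1 : cos θ ^ 2 = 1 := by have := sin_sq_add_cos_sq θ; rw [h] at this; linarith
  rw [quasiRad, quasiDen, pow_mul, h1, h]
  norm_num

lemma quasiCos_zero (k : ℕ) : quasiCos k 0 = 1 := by
  rw [quasiCos, quasiRad_of_sin_eq_zero sin_zero]; simp

lemma quasiCos_pi (k : ℕ) : quasiCos k π = -1 := by
  rw [quasiCos, quasiRad_of_sin_eq_zero sin_pi]; simp

lemma quasiCos_two_pi (k : ℕ) : quasiCos k (2 * π) = 1 := by
  rw [quasiCos, quasiRad_of_sin_eq_zero sin_two_pi]; simp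

lemma quasiSin_zero (k : ℕ) : quasiSin k 0 = 0 := by simp [quasiSin]

lemma quasiSin_two_pi (k : ℕ) : quasiSin k (2 * π) = 0 := by simp [quasiSin]

lemma quasiSin_nonneg {k : ℕ} {θ : ℝ} (h : θ ∈ Icc 0 π) : 0 ≤ quasiSin k θ :=
  mul_nonneg (sin_nonneg_of_mem_Icc h) (pow_nonneg (quasiRad_pos k θ).le _)

lemma quasiSin_nonpos {k : ℕ} {θ : ℝ} (h : θ ∈ Icc π (2 * π)) : quasiSin k θ ≤ 0 := by
  refine mul_nonpos_of_nonpos_of_nonneg ?_ (pow_nonneg (quasiRad_pos k θ).le _)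
  have := sin_nonneg_of_nonneg_of_le_pi (x := θ - π) (by linarith [h.1]) (by linarith [h.2])
  rw [sin_sub_pi] at this
  linarith

/-- The only such θ is π. Hence the transversal, where X > 0, is not met before a full turn. -/
lemma quasiCos_neg_of_quasiSin_eq_zero {k : ℕ} {θ : ℝ} (h : θ ∈ Ioo 0 (2 * π))
    (h0 : quasiSin k θ = 0) : quasiCos k θ < 0 := by
  have hs : sin θ = 0 := by
    rcases mul_eq_zero.1 h0 with h1 | h1
    · exact h1
    · exact absurd h1 (pow_pos (quasiRad_pos k θ) _).ne'
  obtain ⟨n, hn⟩ := sin_eq_zero_iff.1 hs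
  have hpi := pi_pos
  have h1 : (0 : ℝ) < n := by
    by_contra hc; push Not at hc
    nlinarith [h.1]
  have h2 : (n : ℝ) < 2 := by
    by_contra hc; push Not at hc
    nlinarith [h.2]
  have : n = 1 := by
    have h1' : 0 < n := by exact_mod_cast h1
    have h2' : n < 2 := by exact_mod_cast h2
    omega
  subst this
  have : θ = π := by rw [← hn]; simp
  rw [this, quasiCos_pi]; norm_num

/-! ### Integrals over a full turn -/

/-- Integrals of functions of `quasiCos` against `d quasiCos` over a full turn vanish. -/
lemma integral_comp_quasiCos_eq_zero {k : ℕ} (hk : 1 ≤ k) {u : ℝ → ℝ} (hu : Continuous u) :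
    ∫ θ in (0 : ℝ)..(2 * π), u (quasiCos k θ) * (quasiSpeed k θ * quasiSin k θ) = 0 := by
  have hC := continuous_quasiCos hk
  have hS := continuous_quasiSin hk
  have hm := continuous_quasiSpeed k
  have := intervalIntegral.integral_comp_mul_deriv (a := 0) (b := 2 * π) (f := quasiCos k)
    (f' := fun θ => -(quasiSpeed k θ * quasiSin k θ)) (g := u)
    (fun θ _ => hasDerivAt_quasiCos hk θ) (by fun_prop) hu
  rw [quasiCos_zero, quasiCos_two_pi, intervalIntegral.integral_same] at this
  simpa using this

/-- `∫_0^(2π) Y^2 X^n dφ` on the curve `X^(2k) + Y^2 = 1` in terms of a beta integral. -/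
lemma integral_quasiSin_sq_mul_quasiCos_pow {k : ℕ} (hk : 1 ≤ k) (n : ℕ) :
    ∫ θ in (0 : ℝ)..(2 * π), quasiSpeed k θ * (quasiSin k θ ^ 2 * quasiCos k θ ^ n) =
      2 * (1 + (-1) ^ n) * ∫ s in (0 : ℝ)..1, s ^ n * √(1 - s ^ (2 * k)) := by
  have hC := continuous_quasiCos hk
  have hS := continuous_quasiSin hk
  have hm := continuous_quasiSpeed k
  set u : ℝ → ℝ := fun s => s ^ n * √(1 - s ^ (2 * k)) with hu
  have huc : Continuous u := by fun_prop
  -- The sign of Y is constant on each half turn, so s = X(θ) is a valid substitution there, and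
  -- both halves contribute the same integral over [-1, 1].
  have hsq : ∀ θ, √(1 - quasiCos k θ ^ (2 * k)) = |quasiSin k θ| := fun θ => by
    rw [← sqrt_sq_eq_abs]; congr 1; linarith [quasiCos_pow_add_quasiSin_sq hk θ]
  have hpi := pi_pos
  have key : ∀ a b, ∫ θ in a..b, u (quasiCos k θ) * (-(quasiSpeed k θ * quasiSin k θ)) =
      ∫ s in quasiCos k a..quasiCos k b, u s := fun a b =>
    intervalIntegral.integral_comp_mul_deriv (f := quasiCos k)
      (f' := fun θ => -(quasiSpeed k θ * quasiSin k θ)) (g := u)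
      (fun θ _ => hasDerivAt_quasiCos hk θ) (by fun_prop) huc
  have hi : ∀ a b, IntervalIntegrable
      (fun θ => quasiSpeed k θ * (quasiSin k θ ^ 2 * quasiCos k θ ^ n))
      MeasureTheory.volume a b := fun a b => Continuous.intervalIntegrable (by fun_prop) _ _
  have h1 : ∫ θ in (0 : ℝ)..π, quasiSpeed k θ * (quasiSin k θ ^ 2 * quasiCos k θ ^ n) =
      ∫ s in (-1 : ℝ)..1, u s := by
    have := key 0 π
    rw [quasiCos_zero, quasiCos_pi, intervalIntegral.integral_symm (-1) 1] at this
    rw [← neg_eq_iff_eq_neg.2 this, ← intervalIntegral.integral_neg]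
    refine intervalIntegral.integral_congr fun θ hθ => ?_
    rw [uIcc_of_le hpi.le] at hθ
    simp only [hu, hsq, abs_of_nonneg (quasiSin_nonneg hθ)]
    ring
  have h2 : ∫ θ in π..(2 * π), quasiSpeed k θ * (quasiSin k θ ^ 2 * quasiCos k θ ^ n) =
      ∫ s in (-1 : ℝ)..1, u s := by
    have := key π (2 * π)
    rw [quasiCos_two_pi, quasiCos_pi] at this
    rw [← this]
    refine intervalIntegral.integral_congr fun θ hθ => ?_
    rw [uIcc_of_le (by linarith)] at hθ
    simp only [hu, hsq, abs_of_nonpos (quasiSin_nonpos hθ)]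
    ring
  have h3 : ∫ s in (-1 : ℝ)..1, u s = (1 + (-1) ^ n) * ∫ s in (0 : ℝ)..1, u s := by
    have hneg : ∫ s in (-1 : ℝ)..0, u s = (-1) ^ n * ∫ s in (0 : ℝ)..1, u s := by
      have := intervalIntegral.integral_comp_neg (a := 0) (b := 1) u
      rw [neg_zero] at this
      rw [← this, ← intervalIntegral.integral_const_mul]
      refine intervalIntegral.integral_congr fun s _ => ?_
      simp only [hu, (even_two_mul k).neg_pow]
      rw [neg_pow s n]; ring
    rw [← intervalIntegral.integral_add_adjacent_intervals (huc.intervalIntegrable (-1) 0)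
      (huc.intervalIntegrable 0 1), hneg]
    ring
  rw [← intervalIntegral.integral_add_adjacent_intervals (hi 0 π) (hi π (2 * π)), h1, h2, h3]
  ring

/-- Strict positivity makes the sign of the leading displacement coefficient that of F(0) or F'(0).
-/
lemma integral_pow_mul_sqrt_pos {k : ℕ} (hk : 1 ≤ k) (n : ℕ) :
    0 < ∫ s in (0 : ℝ)..1, s ^ n * √(1 - s ^ (2 * k)) := by
  refine intervalIntegral.intervalIntegral_pos_of_pos_on
    (Continuous.intervalIntegrable (by fun_prop) _ _) (fun s hs => ?_) one_pos
  have : s ^ (2 * k) < 1 := pow_lt_one₀ hs.1.le hs.2 (by omega)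
  have h0 := hs.1
  have : 0 < √(1 - s ^ (2 * k)) := sqrt_pos.2 (by linarith)
  positivity

/-! ### Continuous functions on one turn and their primitives -/

/-- The Banach algebra of continuous functions on `[0, 2π]`. -/
abbrev TurnAlg : Type := C(Icc (0 : ℝ) (2 * π), ℝ)

instance : Nonempty (Icc (0 : ℝ) (2 * π)) := ⟨⟨0, left_mem_Icc.2 two_pi_pos.le⟩⟩

/-- The constant extension to `ℝ` of a continuous function on `[0, 2π]`. -/
def turnExtend (x : TurnAlg) : ℝ → ℝ := IccExtend two_pi_pos.le x

lemma continuous_turnExtend (x : TurnAlg) : Continuous (turnExtend x) := x.continuous.Icc_extend'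

lemma turnExtend_of_mem (x : TurnAlg) {θ : ℝ} (h : θ ∈ Icc 0 (2 * π)) :
    turnExtend x θ = x ⟨θ, h⟩ := IccExtend_of_mem _ _ h

lemma abs_turnExtend_le (x : TurnAlg) (θ : ℝ) : |turnExtend x θ| ≤ ‖x‖ := x.norm_coe_le_norm _

/-- Restriction of a continuous function to `[0, 2π]`. -/
def turnRestrict (u : ℝ → ℝ) (hu : Continuous u) : TurnAlg := ⟨fun θ => u θ, by fun_prop⟩

/-- The operator `x ↦ ∫_0^θ x`. -/
def turnIntegral : TurnAlg →L[ℝ] TurnAlg :=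
  LinearMap.mkContinuous
    { toFun := fun x => ⟨fun θ => ∫ s in (0 : ℝ)..θ, turnExtend x s,
        (intervalIntegral.continuous_primitive
          (fun a b => (continuous_turnExtend x).intervalIntegrable a b) 0).comp
            continuous_subtype_val⟩
      map_add' := fun x y => by
        ext θ
        exact intervalIntegral.integral_add ((continuous_turnExtend x).intervalIntegrable _ _)
          ((continuous_turnExtend y).intervalIntegrable _ _)
      map_smul' := fun c x => by
        ext θ
        exact intervalIntegral.integral_const_mul c (turnExtend x) }
    (2 * π) (fun x => by
      refine (ContinuousMap.norm_le _ (by positivity)).2 fun θ => ?_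
      have := intervalIntegral.norm_integral_le_of_norm_le_const (a := 0) (b := θ)
        (f := turnExtend x) (C := ‖x‖) (fun s _ => abs_turnExtend_le x s)
      refine this.trans ?_
      rw [sub_zero, abs_of_nonneg θ.2.1, mul_comm]
      exact mul_le_mul_of_nonneg_right θ.2.2 (norm_nonneg _))

lemma turnIntegral_apply (x : TurnAlg) (θ : Icc (0 : ℝ) (2 * π)) :
    turnIntegral x θ = ∫ s in (0 : ℝ)..θ, turnExtend x s := rfl

/-- Evaluation after a full turn. -/
def turnEval : TurnAlg →L[ℝ] ℝ :=
  ContinuousMap.evalCLM ℝ ⟨2 * π, right_mem_Icc.2 two_pi_pos.le⟩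

lemma turnEval_turnIntegral (x : TurnAlg) :
    turnEval (turnIntegral x) = ∫ s in (0 : ℝ)..2 * π, turnExtend x s := rfl

/-- `∫ x (∫ x) = (∫ x)² / 2`. -/
lemma turnEval_turnIntegral_mul_self (x : TurnAlg) :
    2 * turnEval (turnIntegral (x * turnIntegral x)) = turnEval (turnIntegral x) ^ 2 := by
  set I : ℝ → ℝ := fun θ => ∫ s in (0 : ℝ)..θ, turnExtend x s with hI
  have hx := continuous_turnExtend x
  have hd : ∀ θ, HasDerivAt I (turnExtend x θ) θ := fun θ =>
    intervalIntegral.integral_hasDerivAt_right (hx.intervalIntegrable _ _)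
      (hx.stronglyMeasurableAtFilter _ _) hx.continuousAt
  have hIc : Continuous I := continuous_iff_continuousAt.2 fun θ => (hd θ).continuousAt
  have h1 : ∫ θ in (0 : ℝ)..2 * π, 2 * (turnExtend x θ * I θ) = I (2 * π) ^ 2 - I 0 ^ 2 := by
    refine intervalIntegral.integral_eq_sub_of_hasDerivAt (f := fun θ => I θ ^ 2)
      (fun θ _ => ((hd θ).pow 2).congr_deriv ?_) (Continuous.intervalIntegrable (by fun_prop) _ _)
    push_cast; ring
  have h0 : I 0 = 0 := intervalIntegral.integral_same
  rw [turnEval_turnIntegral, turnEval_turnIntegral, ← intervalIntegral.integral_const_mul]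
  rw [h0] at h1
  refine Eq.trans ?_ (h1.trans (by simp [hI]))
  refine intervalIntegral.integral_congr fun θ hθ => ?_
  rw [uIcc_of_le two_pi_pos.le] at hθ
  simp only [turnExtend_of_mem _ hθ, ContinuousMap.mul_apply, turnIntegral_apply, hI]

/-! ### Analytic functional calculus and the implicit function theorem -/

/-- A scalar function analytic at `0` acts analytically on small elements of an algebra of
continuous functions. -/
theorem exists_analyticAt_lift_continuousMap {X : Type*} [TopologicalSpace X] [CompactSpace X]
    [Nonempty X] {F : ℝ → ℝ} (hF : AnalyticAt ℝ F 0) :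
    ∃ Φ : C(X, ℝ) → C(X, ℝ), AnalyticAt ℝ Φ 0 ∧ Φ 0 = F 0 • (1 : C(X, ℝ)) ∧
      HasFDerivAt Φ (deriv F 0 • ContinuousLinearMap.id ℝ C(X, ℝ)) 0 ∧
      ∀ᶠ y in 𝓝 (0 : C(X, ℝ)), ∀ t, Φ y t = F (y t) := by
  obtain ⟨P, r, hP⟩ := hF
  set a : ℕ → ℝ := P.coeff with ha
  set Q := FormalMultilinearSeries.ofScalars C(X, ℝ) a with hQ
  -- The coefficient norms are unchanged in C(X, ℝ), since ‖1‖ = 1 for nonempty X; so no convergence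
  -- radius is lost.
  have hrad : r ≤ Q.radius := by
    refine hP.r_le.trans ?_
    refine FormalMultilinearSeries.radius_le_of_le (fun {n} => ?_)
    rw [hQ, FormalMultilinearSeries.ofScalars_norm, ha,
      ← FormalMultilinearSeries.norm_apply_eq_norm_coef]
  have hQs : HasFPowerSeriesOnBall (Q.sum) Q 0 r :=
    (Q.hasFPowerSeriesOnBall (hP.r_pos.trans_le hrad)).mono hP.r_pos hrad
  have h0 : a 0 = F 0 := by
    rw [ha, ← hP.coeff_zero (fun _ => (0 : ℝ))]
    exact congrArg (P 0) (Subsingleton.elim _ _)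
  have h1 : deriv F 0 = a 1 := hP.hasFPowerSeriesAt.deriv
  refine ⟨Q.sum, ⟨Q, r, hQs⟩, ?_, ?_, ?_⟩
  · rw [← hQs.coeff_zero (fun _ => 0), hQ, ← h0, FormalMultilinearSeries.ofScalars]
    simp
  · have := hQs.hasFPowerSeriesAt.hasFDerivAt
    refine this.congr_fderiv ?_
    ext1 y
    simp [hQ, FormalMultilinearSeries.ofScalars, h1]
  · have : Metric.eball (0 : C(X, ℝ)) r ∈ 𝓝 0 := Metric.eball_mem_nhds _ hP.r_pos
    filter_upwards [this] with y hy t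
    have hs := (hQs.hasSum hy).mapL (ContinuousMap.evalCLM ℝ t)
    have hyt : y t ∈ Metric.eball (0 : ℝ) r := by
      rw [Metric.mem_eball, edist_zero_right] at hy ⊢
      refine lt_of_le_of_lt ?_ hy
      rw [enorm_le_iff_norm_le]
      exact y.norm_coe_le_norm t
    have hs' := hP.hasSum hyt
    simp only [zero_add] at hs hs'
    refine hs.unique (hs'.congr_fun fun n => ?_)
    simp [hQ, FormalMultilinearSeries.ofScalars, ha, mul_comm]

open scoped ContDiff in
/-- The analytic implicit function theorem for `x = 1 + ε^p K(G(ε, x))`. -/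
theorem exists_analyticAt_fixedPoint {A : Type*} [NormedRing A] [NormedAlgebra ℝ A]
    [CompleteSpace A] (K : A →L[ℝ] A) {G : ℝ × A → A} (hG : AnalyticAt ℝ G (0, 1)) {p : ℕ}
    (hp : 1 ≤ p) :
    ∃ x : ℝ → A, AnalyticAt ℝ x 0 ∧ x 0 = 1 ∧
      ∀ᶠ ε in 𝓝 (0 : ℝ), x ε = 1 + ε ^ p • K (G (ε, x ε)) := by
  set H : ℝ × A → A := fun q => q.2 - (1 + q.1 ^ p • K (G q)) with hH
  have hKG : AnalyticAt ℝ (fun q => K (G q)) ((0 : ℝ), (1 : A)) :=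
    (K.analyticAt _).comp hG
  have hHa : AnalyticAt ℝ H (0, 1) := by
    refine analyticAt_snd.sub (analyticAt_const.add ?_)
    exact (analyticAt_fst.pow p).smul hKG
  have hHc : ContDiffAt ℝ ω H (0, 1) := hHa.contDiffAt
  -- At ε = 0 the factor ε^p vanishes because p ≥ 1, so the partial derivative in x is the identity.
  have hcomp : fderiv ℝ H (0, 1) ∘L .inr ℝ ℝ A = ContinuousLinearMap.id ℝ A := by
    have h1 : HasFDerivAt (fun y : A => H (0, y)) (fderiv ℝ H (0, 1) ∘L .inr ℝ ℝ A) 1 :=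
      (hHa.differentiableAt.hasFDerivAt).comp (1 : A) (hasFDerivAt_prodMk_right (0 : ℝ) (1 : A))
    have h2 : HasFDerivAt (fun y : A => H (0, y)) (ContinuousLinearMap.id ℝ A) 1 := by
      have : (fun y : A => H (0, y)) = fun y => y - 1 := by
        funext y; simp [hH, zero_pow (by omega : p ≠ 0)]
      rw [this]
      exact (hasFDerivAt_id _).sub_const _
    exact h1.unique h2
  have hinv : (fderiv ℝ H (0, 1) ∘L .inr ℝ ℝ A).IsInvertible := by
    rw [hcomp]; exact ⟨ContinuousLinearEquiv.refl ℝ A, rfl⟩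
  have hω : (ω : WithTop ℕ∞) ≠ 0 := by simp
  refine ⟨hHc.implicitFunction hω hinv, ?_, ?_, ?_⟩
  · exact (hHc.contDiffAt_implicitFunction hω hinv).analyticAt
  · exact hHc.implicitFunction_apply_self hω hinv
  · filter_upwards [hHc.eventually_apply_implicitFunction hω hinv] with ε hε
    have : H (0, 1) = 0 := by simp [hH, zero_pow (by omega : p ≠ 0)]
    rw [this] at hε
    exact sub_eq_zero.1 hε

/-! ### The polar equation and the expansion of its solutions -/

/-- The friction coefficient, divided by `z^l`, of the Liénard form of the system. -/
def lienardCoef (k l : ℕ) (F : ℝ → ℝ) (z : ℝ) : ℝ := (k + l + 1) * F z + z * deriv F z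

/-- The denominator of the polar equation. -/
def polarDen (k l p : ℕ) (F : ℝ → ℝ) (r θ : ℝ) : ℝ :=
  1 + r ^ p * (quasiCos k θ ^ (l + 1) * quasiSin k θ * lienardCoef k l F (r * quasiCos k θ) / k) +
    r ^ (2 * p) * (quasiCos k θ ^ (2 * l + 2) * F (r * quasiCos k θ) ^ 2)

/-- The numerator of the polar equation. -/
def polarNum (k l p : ℕ) (F : ℝ → ℝ) (r θ : ℝ) : ℝ :=
  quasiSin k θ ^ 2 * quasiCos k θ ^ l * lienardCoef k l F (r * quasiCos k θ) / k +
    r ^ p * (quasiSin k θ * quasiCos k θ ^ (2 * l + 1) * F (r * quasiCos k θ) ^ 2)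

/-- The beta integral `∫_0^1 s^n √(1 - s^(2k)) ds`. -/
def betaInt (k n : ℕ) : ℝ := ∫ s in (0 : ℝ)..1, s ^ n * √(1 - s ^ (2 * k))

lemma analyticAt_lienardCoef {F : ℝ → ℝ} (hF : AnalyticAt ℝ F 0) (k l : ℕ) :
    AnalyticAt ℝ (lienardCoef k l F) 0 := by
  have := hF.deriv
  unfold lienardCoef
  fun_prop

lemma lienardCoef_zero (k l : ℕ) (F : ℝ → ℝ) : lienardCoef k l F 0 = (k + l + 1) * F 0 := by
  simp [lienardCoef]

lemma deriv_lienardCoef {F : ℝ → ℝ} (hF : AnalyticAt ℝ F 0) (k l : ℕ) :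
    deriv (lienardCoef k l F) 0 = (k + l + 2) * deriv F 0 := by
  have h1 := hF.differentiableAt.hasDerivAt
  have h2 := hF.deriv.differentiableAt.hasDerivAt
  have := (h1.const_mul (k + l + 1 : ℝ)).add ((hasDerivAt_id (0 : ℝ)).mul h2)
  rw [show lienardCoef k l F = _ from rfl]
  refine (HasDerivAt.deriv (f := lienardCoef k l F) this).trans ?_
  simp
  ring

lemma turnEval_turnIntegral_eq {x : TurnAlg} {u : ℝ → ℝ}
    (h : ∀ θ : Icc (0 : ℝ) (2 * π), x θ = u θ) :
    turnEval (turnIntegral x) = ∫ s in (0 : ℝ)..2 * π, u s := by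
  rw [turnEval_turnIntegral]
  refine intervalIntegral.integral_congr fun θ hθ => ?_
  rw [uIcc_of_le two_pi_pos.le] at hθ
  simp only [turnExtend_of_mem _ hθ, h]

/-- The numerator of the lifted polar equation. -/
def liftNum {A : Type*} [NormedCommRing A] [NormedAlgebra ℝ A] (Φ Ψ : A → A) (c s : A)
    (k l p : ℕ) (q : ℝ × A) : A :=
  (1 / (k : ℝ)) • (s ^ 2 * c ^ l * Ψ (q.1 • (q.2 * c))) +
    q.1 ^ p • (q.2 ^ p * (s * c ^ (2 * l + 1) * Φ (q.1 • (q.2 * c)) ^ 2))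

/-- The denominator of the lifted polar equation. -/
def liftDen {A : Type*} [NormedCommRing A] [NormedAlgebra ℝ A] (Φ Ψ : A → A) (c s : A)
    (k l p : ℕ) (q : ℝ × A) : A :=
  1 + q.1 ^ p • (q.2 ^ p * ((1 / (k : ℝ)) • (c ^ (l + 1) * s * Ψ (q.1 • (q.2 * c))))) +
    q.1 ^ (2 * p) • (q.2 ^ (2 * p) * (c ^ (2 * l + 2) * Φ (q.1 • (q.2 * c)) ^ 2))

/-- The polar equation in a Banach algebra: existence of an analytic family of solutions, with the
expansion of its right-hand side to first order. -/
theorem exists_lifted_solution {A : Type*} [NormedCommRing A] [NormedAlgebra ℝ A]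
    [CompleteSpace A] (K : A →L[ℝ] A) {Φ Ψ : A → A} (c s m : A) {f0 M0 M1 : ℝ}
    (hΦa : AnalyticAt ℝ Φ 0) (hΦ0 : Φ 0 = f0 • 1) (hΨa : AnalyticAt ℝ Ψ 0)
    (hΨ0 : Ψ 0 = M0 • 1) (hΨd : HasFDerivAt Ψ (M1 • ContinuousLinearMap.id ℝ A) 0)
    (k l : ℕ) {p : ℕ} (hp : 1 ≤ p) :
    ∃ x g : ℝ → A, AnalyticAt ℝ x 0 ∧ x 0 = 1 ∧ AnalyticAt ℝ g 0 ∧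
      Tendsto (fun ε => liftDen Φ Ψ c s k l p (ε, x ε)) (𝓝 0) (𝓝 1) ∧
      (∀ᶠ ε in 𝓝 (0 : ℝ), x ε = 1 + ε ^ p • K (g ε)) ∧
      (∀ᶠ ε in 𝓝 (0 : ℝ), g ε * liftDen Φ Ψ c s k l p (ε, x ε) =
        m * x ε ^ (p + 1) * liftNum Φ Ψ c s k l p (ε, x ε)) ∧
      g 0 = (M0 / k) • (m * (s ^ 2 * c ^ l)) ∧
      deriv g 0 = ((p + 1) * (p * 0 ^ (p - 1)) : ℝ) • (g 0 * K (g 0)) +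
        (M1 / k) • (m * (s ^ 2 * c ^ (l + 1))) +
        ((p * 0 ^ (p - 1)) * f0 ^ 2 : ℝ) • (m * (s * c ^ (2 * l + 1))) -
        ((p * 0 ^ (p - 1)) * (M0 / k) ^ 2 : ℝ) • (m * (s ^ 3 * c ^ (2 * l + 1))) := by
  set α : ℝ × A → A := fun q => q.1 • (q.2 * c) with hα
  set N := liftNum Φ Ψ c s k l p with hN
  set D := liftDen Φ Ψ c s k l p with hD
  -- `Ring.inverse` is total; it is a true inverse, and analytic, near (0, 1), where D = 1.
  set G : ℝ × A → A := fun q => m * q.2 ^ (p + 1) * N q * Ring.inverse (D q) with hG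
  have hp0 : p ≠ 0 := by omega
  have hα0 : α (0, 1) = 0 := by simp [hα]
  have hfst : AnalyticAt ℝ (fun q : ℝ × A => q.1) (0, 1) := analyticAt_fst
  have hsnd : AnalyticAt ℝ (fun q : ℝ × A => q.2) (0, 1) := analyticAt_snd
  have hαa : AnalyticAt ℝ α (0, 1) := by simp only [hα]; fun_prop
  have hΦα : AnalyticAt ℝ (fun q => Φ (α q)) (0, 1) :=
    AnalyticAt.fun_comp (by rw [hα0]; exact hΦa) hαa
  have hΨα : AnalyticAt ℝ (fun q => Ψ (α q)) (0, 1) :=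
    AnalyticAt.fun_comp (by rw [hα0]; exact hΨa) hαa
  have hNa : AnalyticAt ℝ N (0, 1) :=
    (((analyticAt_const (v := s ^ 2 * c ^ l)).mul hΨα).const_smul (c := 1 / (k : ℝ))).add
      ((hfst.pow p).smul ((hsnd.pow p).mul (analyticAt_const.mul (hΦα.pow 2))))
  have hDa : AnalyticAt ℝ D (0, 1) :=
    ((analyticAt_const (v := 1)).add ((hfst.pow p).smul ((hsnd.pow p).mul
      (((analyticAt_const (v := c ^ (l + 1) * s)).mul hΨα).const_smul (c := 1 / (k : ℝ)))))).add
      ((hfst.pow (2 * p)).smul ((hsnd.pow (2 * p)).mul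
        ((analyticAt_const (v := c ^ (2 * l + 2))).mul (hΦα.pow 2))))
  have hD0 : D (0, 1) = 1 := by simp [hD, liftDen, hp0]
  have hGa : AnalyticAt ℝ G (0, 1) := by
    have hi : AnalyticAt ℝ (fun q => Ring.inverse (D q)) (0, 1) := by
      refine AnalyticAt.fun_comp ?_ hDa
      rw [hD0]
      exact analyticAt_inverse (1 : Aˣ)
    simp only [hG]
    fun_prop
  obtain ⟨x, hxa, hx0, hx⟩ := exists_analyticAt_fixedPoint K hGa hp
  have hcurve : AnalyticAt ℝ (fun ε : ℝ => (ε, x ε)) 0 := analyticAt_id.prod hxa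
  set g : ℝ → A := fun ε => G (ε, x ε) with hg
  have hga : AnalyticAt ℝ g 0 := AnalyticAt.fun_comp (by rw [hx0]; exact hGa) hcurve
  have hcurve_tendsto : Tendsto (fun ε : ℝ => (ε, x ε)) (𝓝 0) (𝓝 (0, 1)) := by
    have := hcurve.continuousAt.tendsto
    rwa [hx0] at this
  have hDt : Tendsto (fun ε => D (ε, x ε)) (𝓝 0) (𝓝 1) := by
    rw [← hD0]; exact hDa.continuousAt.tendsto.comp hcurve_tendsto
  have hev_unit : ∀ᶠ ε in 𝓝 (0 : ℝ), IsUnit (D (ε, x ε)) :=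
    hDt.eventually (Units.nhds (1 : Aˣ))
  have hgD : ∀ᶠ ε in 𝓝 (0 : ℝ), g ε * D (ε, x ε) = m * x ε ^ (p + 1) * N (ε, x ε) := by
    filter_upwards [hev_unit] with ε hε
    simp only [hg, hG]
    rw [mul_assoc, Ring.inverse_mul_cancel _ hε, mul_one]
  have hN0 : N (0, 1) = (M0 / k) • (s ^ 2 * c ^ l) := by
    change (1 / (k : ℝ)) • (s ^ 2 * c ^ l * Ψ (α (0, 1))) + (0 : ℝ) ^ p • _ = _
    rw [hα0, hΨ0, zero_pow hp0, zero_smul, add_zero, mul_smul_comm, mul_one, smul_smul]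
    congr 1; ring
  have hg0 : g 0 = (M0 / k) • (m * (s ^ 2 * c ^ l)) := by
    simp only [hg, hG, hx0, hD0, hN0, Ring.inverse_one]
    simp
  refine ⟨x, g, hxa, hx0, hga, hDt, hx, hgD, hg0, ?_⟩
  -- The derivative of ε^p at 0: it is 1 for p = 1 and 0 otherwise, so one computation covers both
  -- cases.
  set e : ℝ := p * 0 ^ (p - 1) with he
  have hpow : HasDerivAt (fun ε : ℝ => ε ^ p) e 0 := hasDerivAt_pow p 0
  have hpow2 : HasDerivAt (fun ε : ℝ => ε ^ (2 * p)) 0 0 := by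
    refine (hasDerivAt_pow (2 * p) 0).congr_deriv ?_
    rw [zero_pow (by omega), mul_zero]
  have hgd := hga.differentiableAt.hasDerivAt
  have hxd : HasDerivAt x (e • K (g 0)) 0 := by
    have h1 : HasDerivAt (fun ε => 1 + ε ^ p • K (g ε)) _ 0 :=
      (hpow.smul (K.hasFDerivAt.comp_hasDerivAt (0 : ℝ) hgd)).const_add 1
    refine (h1.congr_of_eventuallyEq hx).congr_deriv ?_
    simp [hp0]
  have hαd : HasDerivAt (fun ε => α (ε, x ε)) c 0 := by
    have h1 := (hasDerivAt_id (0 : ℝ)).smul (hxd.mul_const c)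
    refine h1.congr_deriv ?_
    simp [hx0]
  have hα00 : α (0, x 0) = 0 := by rw [hx0, hα0]
  have hΨd' : HasDerivAt (fun ε => Ψ (α (ε, x ε))) (M1 • c) 0 := by
    have h1 : HasFDerivAt Ψ (M1 • ContinuousLinearMap.id ℝ A) (α (0, x 0)) := by
      rw [hα00]; exact hΨd
    exact (h1.comp_hasDerivAt (0 : ℝ) hαd).congr_deriv (by simp)
  -- The value of Φ' is irrelevant: it enters only multiplied by positive powers of ε.
  have hΦd' : ∃ Φ', HasDerivAt (fun ε => Φ (α (ε, x ε))) Φ' 0 := by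
    have h1 : HasFDerivAt Φ (fderiv ℝ Φ 0) (α (0, x 0)) := by
      rw [hα00]; exact hΦa.differentiableAt.hasFDerivAt
    exact ⟨_, h1.comp_hasDerivAt (0 : ℝ) hαd⟩
  obtain ⟨Φ', hΦd'⟩ := hΦd'
  have hNd : HasDerivAt (fun ε => N (ε, x ε))
      ((M1 / k) • (s ^ 2 * c ^ (l + 1)) + (e * f0 ^ 2) • (s * c ^ (2 * l + 1))) 0 := by
    have h1 := ((hΨd'.const_mul (s ^ 2 * c ^ l)).const_smul (1 / (k : ℝ))).add
      (hpow.smul ((hxd.pow p).mul ((hΦd'.pow 2).const_mul (s * c ^ (2 * l + 1)))))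
    refine h1.congr_deriv ?_
    simp only [Pi.mul_apply, Pi.pow_apply, zero_pow hp0, zero_smul, zero_add, hx0, hα0, hΦ0,
      one_pow, one_mul, smul_pow]
    simp only [mul_smul_comm, smul_smul, mul_one, pow_succ c l, mul_assoc]
    congr 2
    ring
  have hDd : HasDerivAt (fun ε => D (ε, x ε)) ((e * (M0 / k)) • (c ^ (l + 1) * s)) 0 := by
    have h1 := ((hpow.smul ((hxd.pow p).mul
      ((hΨd'.const_mul (c ^ (l + 1) * s)).const_smul (1 / (k : ℝ))))).const_add 1).add
      (hpow2.smul ((hxd.pow (2 * p)).mul ((hΦd'.pow 2).const_mul (c ^ (2 * l + 2)))))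
    refine h1.congr_deriv ?_
    have h2p : 2 * p ≠ 0 := by omega
    simp only [Pi.mul_apply, Pi.pow_apply, Pi.smul_apply, zero_pow hp0, zero_pow h2p, zero_smul,
      zero_add, add_zero, hx0, hα0, hΨ0, one_pow, one_mul]
    simp only [mul_smul_comm, smul_smul, mul_one]
    congr 1
    ring
  -- Differentiating g D = m x^(p+1) N avoids the derivative of an inverse.
  have heq : deriv g 0 * 1 + g 0 * ((e * (M0 / k)) • (c ^ (l + 1) * s)) =
      m * ((p + 1) * e) • K (g 0) * N (0, 1) +
      m * ((M1 / k) • (s ^ 2 * c ^ (l + 1)) + (e * f0 ^ 2) • (s * c ^ (2 * l + 1))) := by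
    have h1 := hgd.mul hDd
    have h2 := ((hxd.pow (p + 1)).const_mul m).mul hNd
    have h3 := h1.unique (h2.congr_of_eventuallyEq hgD)
    simp only [hx0, hD0, Pi.pow_apply, one_pow, mul_one] at h3 ⊢
    rw [h3]
    congr 3
    simp only [Algebra.smul_def, map_mul, map_add, map_natCast, map_one, mul_assoc, Nat.cast_add,
      Nat.cast_one]
  have hgd' : deriv g 0 = ((p + 1) * e) • (g 0 * K (g 0)) +
      (M1 / k) • (m * (s ^ 2 * c ^ (l + 1))) + (e * f0 ^ 2) • (m * (s * c ^ (2 * l + 1))) -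
      (e * (M0 / k) ^ 2) • (m * (s ^ 3 * c ^ (2 * l + 1))) := by
    have h1 : g 0 = m * N (0, 1) := by rw [hN0, hg0, mul_smul_comm]
    have h2 : g 0 * ((e * (M0 / k)) • (c ^ (l + 1) * s)) =
        (e * (M0 / k) ^ 2) • (m * (s ^ 3 * c ^ (2 * l + 1))) := by
      rw [hg0, smul_mul_smul_comm]
      congr 1 <;> ring
    rw [h2, mul_one, ← eq_sub_iff_add_eq] at heq
    rw [heq, h1, mul_add, mul_smul_comm, smul_mul_assoc, mul_right_comm]
    simp only [mul_smul_comm]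
    rw [add_assoc]
  exact hgd'

/-- Small solutions of the polar equation over a full turn, and the expansion of the
displacement. -/
theorem exists_polar_solution {F : ℝ → ℝ} (hF : AnalyticAt ℝ F 0) {k l p : ℕ} (hk : 1 ≤ k)
    (hp : 1 ≤ p) :
    ∃ η : ℝ → ℝ, AnalyticAt ℝ η 0 ∧
      η 0 = lienardCoef k l F 0 / k * (2 * (1 + (-1) ^ l) * betaInt k l) ∧
      deriv η 0 =
        deriv (lienardCoef k l F) 0 / k * (2 * (1 + (-1) ^ (l + 1)) * betaInt k (l + 1)) +
          (if p = 1 then η 0 ^ 2 else 0) ∧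
      ∀ δ > 0, ∀ᶠ ε in 𝓝[>] (0 : ℝ), ∃ R : ℝ → ℝ, R 0 = ε ∧
        R (2 * π) = ε + ε ^ (p + 1) * η ε ∧ ∀ θ ∈ Icc 0 (2 * π),
          0 < R θ ∧ R θ < δ ∧ 0 < polarDen k l p F (R θ) θ ∧
          HasDerivAt R (quasiSpeed k θ * R θ ^ (p + 1) * polarNum k l p F (R θ) θ /
            polarDen k l p F (R θ) θ) θ := by
  obtain ⟨Φ, hΦa, hΦ0, -, hΦ⟩ :=
    exists_analyticAt_lift_continuousMap (X := Icc (0 : ℝ) (2 * π)) hF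
  obtain ⟨Ψ, hΨa, hΨ0, hΨd, hΨ⟩ :=
    exists_analyticAt_lift_continuousMap (X := Icc (0 : ℝ) (2 * π)) (analyticAt_lienardCoef hF k l)
  set c : TurnAlg := turnRestrict _ (continuous_quasiCos hk) with hc
  set s : TurnAlg := turnRestrict _ (continuous_quasiSin hk) with hs
  set m : TurnAlg := turnRestrict _ (continuous_quasiSpeed k) with hm
  obtain ⟨x, g, hxa, hx0, hga, hDt, hx, hgD, hg0, hgd'⟩ :=
    exists_lifted_solution turnIntegral c s m hΦa hΦ0 hΨa hΨ0 hΨd k l hp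
  set M0 := lienardCoef k l F 0
  set M1 := deriv (lienardCoef k l F) 0
  have hη0 : turnEval (turnIntegral (g 0)) = M0 / k * (2 * (1 + (-1) ^ l) * betaInt k l) := by
    rw [hg0, map_smul, map_smul, smul_eq_mul, betaInt,
      ← integral_quasiSin_sq_mul_quasiCos_pow hk l]
    congr 1
    exact turnEval_turnIntegral_eq fun θ => rfl
  refine ⟨fun ε => turnEval (turnIntegral (g ε)), ?_, hη0, ?_, ?_⟩
  · exact ((turnEval.comp turnIntegral).analyticAt _).comp hga
  · have hgd := hga.differentiableAt.hasDerivAt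
    have hI1 : turnEval (turnIntegral (m * (s ^ 2 * c ^ (l + 1)))) =
        2 * (1 + (-1) ^ (l + 1)) * betaInt k (l + 1) := by
      rw [betaInt, ← integral_quasiSin_sq_mul_quasiCos_pow hk (l + 1)]
      exact turnEval_turnIntegral_eq fun θ => rfl
    -- Both this integrand and the next have the form u(X) dX up to sign, the next through Y^2 = 1 -
    -- X^(2k).
    have hI2 : turnEval (turnIntegral (m * (s * c ^ (2 * l + 1)))) = 0 := by
      refine (turnEval_turnIntegral_eq fun θ => ?_).trans
        (integral_comp_quasiCos_eq_zero hk (u := fun y => y ^ (2 * l + 1)) (by fun_prop))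
      simp only [ContinuousMap.mul_apply, ContinuousMap.pow_apply, hm, hs, hc, turnRestrict,
        ContinuousMap.coe_mk]
      ring
    have hI3 : turnEval (turnIntegral (m * (s ^ 3 * c ^ (2 * l + 1)))) = 0 := by
      refine (turnEval_turnIntegral_eq fun θ => ?_).trans (integral_comp_quasiCos_eq_zero hk
        (u := fun y => (1 - y ^ (2 * k)) * y ^ (2 * l + 1)) (by fun_prop))
      simp only [ContinuousMap.mul_apply, ContinuousMap.pow_apply, hm, hs, hc, turnRestrict,
        ContinuousMap.coe_mk, ← quasiCos_pow_add_quasiSin_sq hk θ]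
      ring
    have hd : HasDerivAt (fun ε => turnEval (turnIntegral (g ε)))
        (turnEval (turnIntegral (deriv g 0))) 0 :=
      (turnEval.comp turnIntegral).hasFDerivAt.comp_hasDerivAt (0 : ℝ) hgd
    -- For p = 1 the nested term has coefficient p + 1 = 2, which turns it into exactly η(0)^2.
    have hsq := turnEval_turnIntegral_mul_self (g 0)
    rw [hd.deriv, hgd']
    simp only [map_add, map_sub, map_smul, smul_eq_mul, hI1, hI2, hI3, mul_zero, add_zero, sub_zero]
    rw [add_comm]
    congr 1
    split_ifs with h
    · subst h
      rw [← hsq]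
      norm_num
    · rw [zero_pow (by omega)]
      simp
  · intro δ hδ
    have hxt : Tendsto x (𝓝 0) (𝓝 1) := by
      have := hxa.continuousAt.tendsto; rwa [hx0] at this
    have hαt : Tendsto (fun ε : ℝ => ε • (x ε * c)) (𝓝 0) (𝓝 0) := by
      have := tendsto_id.smul (hxt.mul_const c)
      rwa [zero_smul] at this
    -- Applied to x and to the denominator: x < 3/2 with ε < δ/2 gives R = ε x < δ, and the
    -- denominator exceeds 1/2.
    have hpt : ∀ y : TurnAlg, y ∈ Metric.ball (1 : TurnAlg) (1 / 2) → ∀ t,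
        1 / 2 < y t ∧ y t < 3 / 2 := fun y hy t => by
      rw [mem_ball_iff_norm] at hy
      have := (abs_lt.1 (((y - 1).norm_coe_le_norm t).trans_lt hy))
      simp only [ContinuousMap.sub_apply, ContinuousMap.one_apply] at this
      constructor <;> linarith [this.1, this.2]
    have hhalf : (0 : ℝ) < 1 / 2 := by norm_num
    have hev := (hxt.eventually (Metric.ball_mem_nhds _ hhalf)).and
      ((hDt.eventually (Metric.ball_mem_nhds _ hhalf)).and ((hαt.eventually hΦ).and
        ((hαt.eventually hΨ).and (hgD.and hx))))
    filter_upwards [nhdsWithin_le_nhds hev, self_mem_nhdsWithin,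
      nhdsWithin_le_nhds (Iio_mem_nhds (by positivity : (0 : ℝ) < δ / 2))] with
      ε ⟨h1, h2, h3, h4, h5, h6⟩ hε hεδ
    have hε0 : 0 < ε := hε
    have hεδ' : ε < δ / 2 := hεδ
    -- The constant extension of the integrand gives two-sided derivatives also at 0 and 2π.
    set R : ℝ → ℝ := fun θ => ε * (1 + ε ^ p * ∫ u in (0 : ℝ)..θ, turnExtend (g ε) u) with hR
    have hRx : ∀ t : Icc (0 : ℝ) (2 * π), R t = ε * x ε t := fun t => by
      have : x ε t = 1 + ε ^ p * ∫ u in (0 : ℝ)..t, turnExtend (g ε) u := by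
        exact DFunLike.congr_fun h6 t
      rw [this]
    have hRd : ∀ θ, HasDerivAt R (ε * (ε ^ p * turnExtend (g ε) θ)) θ := fun θ => by
      have hc := continuous_turnExtend (g ε)
      exact (((intervalIntegral.integral_hasDerivAt_right (hc.intervalIntegrable _ _)
        (hc.stronglyMeasurableAtFilter _ _) hc.continuousAt).const_mul _).const_add 1).const_mul ε
    refine ⟨R, by simp [hR], ?_, fun θ hθ => ?_⟩
    · simp only [hR, turnEval_turnIntegral]
      ring
    · set t : Icc (0 : ℝ) (2 * π) := ⟨θ, hθ⟩
      have hRt : R θ = ε * x ε t := hRx t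
      have hxt' := hpt _ h1 t
      have hRα : (ε • (x ε * c)) t = R θ * quasiCos k θ := by
        rw [hRt, mul_assoc]; rfl
      have hDen : liftDen Φ Ψ c s k l p (ε, x ε) t = polarDen k l p F (R θ) θ := by
        have e1 : liftDen Φ Ψ c s k l p (ε, x ε) t = 1 + ε ^ p * (x ε t ^ p * ((1 / (k : ℝ)) *
          (quasiCos k θ ^ (l + 1) * quasiSin k θ * Ψ (ε • (x ε * c)) t))) +
          ε ^ (2 * p) * (x ε t ^ (2 * p) * (quasiCos k θ ^ (2 * l + 2) *
            Φ (ε • (x ε * c)) t ^ 2)) := rfl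
        rw [e1, h3, h4, hRα, polarDen, hRt]
        ring
      have hNum : liftNum Φ Ψ c s k l p (ε, x ε) t = polarNum k l p F (R θ) θ := by
        have e1 : liftNum Φ Ψ c s k l p (ε, x ε) t = (1 / (k : ℝ)) *
          (quasiSin k θ ^ 2 * quasiCos k θ ^ l * Ψ (ε • (x ε * c)) t) +
          ε ^ p * (x ε t ^ p * (quasiSin k θ * quasiCos k θ ^ (2 * l + 1) *
            Φ (ε • (x ε * c)) t ^ 2)) := rfl
        rw [e1, h3, h4, hRα, polarNum, hRt]
        ring
      have hDpos : 0 < polarDen k l p F (R θ) θ := by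
        rw [← hDen]; linarith [(hpt _ h2 t).1]
      refine ⟨?_, ?_, hDpos, ?_⟩
      · rw [hRt]; exact mul_pos hε0 (by linarith [hxt'.1])
      · rw [hRt]; nlinarith [hxt'.2]
      · refine (hRd θ).congr_deriv ?_
        rw [turnExtend_of_mem _ hθ, eq_div_iff hDpos.ne', ← hDen, ← hNum]
        have h7 : g ε t * liftDen Φ Ψ c s k l p (ε, x ε) t =
            quasiSpeed k θ * x ε t ^ (p + 1) * liftNum Φ Ψ c s k l p (ε, x ε) t :=
          DFunLike.congr_fun h5 t
        rw [hRt, mul_pow]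
        linear_combination ε ^ (p + 1) * h7

/-! ### From polar solutions to first returns of the planar field -/

/-- A curve that is tangent to `v` at positive speed can be reparametrized to an integral curve. -/
theorem exists_reparametrization {E : Type*} [NormedAddCommGroup E] [NormedSpace ℝ E] {v : E → E}
    {β : ℝ → E} {ω : ℝ → ℝ} {L : ℝ} (hL : 0 < L) (hω : ContinuousOn ω (Icc 0 L))
    (hpos : ∀ θ ∈ Icc 0 L, 0 < ω θ)
    (hβ : ∀ θ ∈ Icc 0 L, HasDerivAt β ((ω θ)⁻¹ • v (β θ)) θ) :
    ∃ (T : ℝ) (σ : ℝ → ℝ), 0 < T ∧ σ 0 = 0 ∧ σ T = L ∧ StrictMono σ ∧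
      IsIntegralCurveOn (β ∘ σ) (fun _ => v) (Icc 0 T) := by
  -- Here ν = dt/dθ. Extended constantly it stays above a positive constant, so its primitive τ is a
  -- bijection of ℝ and σ can be its inverse.
  set ν : ℝ → ℝ := IccExtend hL.le ((Icc 0 L).domRestrict fun θ => (ω θ)⁻¹) with hν
  have hνc : Continuous ν :=
    (continuousOn_iff_continuous_domRestrict.1 (hω.inv₀ fun θ h => (hpos θ h).ne')).Icc_extend'
  have hνω : ∀ θ ∈ Icc 0 L, ν θ = (ω θ)⁻¹ := fun θ h => IccExtend_of_mem _ _ h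
  obtain ⟨C, hC⟩ := (isCompact_Icc.exists_bound_of_continuousOn hω)
  set b : ℝ := (max C 1)⁻¹ with hb
  have hb0 : 0 < b := by positivity
  have hνb : ∀ θ, b ≤ ν θ := fun θ => by
    have h1 := (projIcc 0 L hL.le θ).2
    change b ≤ (ω (projIcc 0 L hL.le θ))⁻¹
    exact inv_anti₀ (hpos _ h1) (((le_abs_self _).trans (hC _ h1)).trans (le_max_left _ _))
  set τ : ℝ → ℝ := fun θ => ∫ s in (0 : ℝ)..θ, ν s with hτ
  have hτd : ∀ θ, HasDerivAt τ (ν θ) θ := fun θ =>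
    intervalIntegral.integral_hasDerivAt_right (hνc.intervalIntegrable _ _)
      (hνc.stronglyMeasurableAtFilter _ _) hνc.continuousAt
  have hτ0 : τ 0 = 0 := intervalIntegral.integral_same
  have hτm : StrictMono τ := strictMono_of_deriv_pos fun θ => by
    rw [(hτd θ).deriv]; exact hb0.trans_le (hνb θ)
  have hτc : Continuous τ := continuous_iff_continuousAt.2 fun θ => (hτd θ).continuousAt
  have hmono : Monotone fun θ => τ θ - b * θ := by
    have hd : ∀ θ, HasDerivAt (fun θ => τ θ - b * θ) (ν θ - b) θ := fun θ => by
      exact ((hτd θ).sub ((hasDerivAt_id θ).const_mul b)).congr_deriv (by simp)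
    refine monotone_of_deriv_nonneg (fun θ => (hd θ).differentiableAt) fun θ => ?_
    rw [(hd θ).deriv]
    linarith [hνb θ]
  have htop : Tendsto τ atTop atTop := by
    refine tendsto_atTop_mono' _ ?_ (tendsto_id.const_mul_atTop hb0)
    filter_upwards [eventually_ge_atTop 0] with θ hθ
    have := hmono hθ
    simp only [hτ0, mul_zero, sub_zero, id] at this ⊢
    linarith
  have hbot : Tendsto τ atBot atBot := by
    refine tendsto_atBot_mono' _ ?_ (tendsto_id.const_mul_atBot hb0)
    filter_upwards [eventually_le_atBot 0] with θ hθ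
    have := hmono hθ
    simp only [hτ0, mul_zero, sub_zero, id] at this ⊢
    linarith
  set e := hτm.orderIsoOfSurjective τ (hτc.surjective htop hbot) with he
  have heτ : ∀ θ, e θ = τ θ := fun θ => rfl
  have hσ0 : e.symm 0 = 0 := by rw [e.symm_apply_eq, heτ, hτ0]
  have hσL : e.symm (τ L) = L := by rw [e.symm_apply_eq, heτ]
  have hT : 0 < τ L := by rw [← hτ0]; exact hτm hL
  refine ⟨τ L, e.symm, hT, hσ0, hσL, e.symm.strictMono, fun t ht => ?_⟩
  have hmem : e.symm t ∈ Icc 0 L := by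
    constructor
    · rw [← hσ0]; exact e.symm.monotone ht.1
    · rw [← hσL]; exact e.symm.monotone ht.2
  have h1 : HasDerivAt e.symm (ν (e.symm t))⁻¹ t :=
    HasDerivAt.of_local_left_inverse (f := τ) e.symm.continuous.continuousAt (hτd _)
      (hb0.trans_le (hνb _)).ne' (Eventually.of_forall fun y => e.apply_symm_apply y)
  have h2 := (hβ _ hmem).scomp t h1
  refine (h2.congr_deriv ?_).hasDerivWithinAt
  rw [hνω _ hmem, inv_inv, smul_smul, mul_inv_cancel₀ (hpos _ hmem).ne', one_smul]
  rfl

/-- The algebra behind the polar form: the velocity of a solution of the polar equation is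
parallel to the vector field. -/
lemma polar_velocity_aux {j p : ℕ} {R C S μ F F' m D N Q : ℝ}
    (hCS : C ^ (2 * (j + 1)) + S ^ 2 = 1)
    (hN : N = S ^ 2 * C ^ (p + j) * m + R ^ p * (S * C ^ (2 * (p + j) + 1) * F ^ 2))
    (hD : D = 1 + R ^ p * (C ^ (p + j + 1) * S * m) +
      R ^ (2 * p) * (C ^ (2 * (p + j) + 2) * F ^ 2))
    (hQ : Q * D = μ * R ^ (p + 1) * N)
    (hm : (j + 1) * m = (j + 1 + (p + j) + 1) * F + R * C * F') :
    (Q * C + R * (-(μ * S))) * D = -(R * S * μ) ∧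
    ((j + 1) * R ^ j * Q * S + R ^ (j + 1) * ((j + 1) * C ^ (2 * j + 1) * μ) +
      (((p + j + 1) * (R * C) ^ (p + j) * (Q * C + R * (-(μ * S)))) * F +
        (R * C) ^ (p + j + 1) * (F' * (Q * C + R * (-(μ * S)))))) * D * R ^ j =
    μ * ((j + 1) * (R * C) ^ (2 * j + 1) +
      (j + 1) * (R ^ (j + 1) * S + (R * C) ^ (p + j + 1) * F) * (R * C) ^ (p + j) * F) := by
  -- N and D are matched so that R^p C N - S D = -S: this is z' = -y up to the time change.
  have hA : (Q * C + R * (-(μ * S))) * D = -(R * S * μ) := by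
    have : (Q * C + R * (-(μ * S))) * D = (Q * D) * C - R * μ * S * D := by ring
    rw [this, hQ, hN, hD]
    ring
  -- This is the part of w' coming from y = R^k S; the part from z^(l+1) F(z) is a multiple of `hA`.
  have hB : ((j + 1) * R ^ j * Q * S + R ^ (j + 1) * ((j + 1) * C ^ (2 * j + 1) * μ)) * D * R ^ j =
      μ * ((j + 1) * (R * C) ^ (2 * j + 1) + (j + 1) * (R * C) ^ (2 * (p + j) + 1) * F ^ 2 +
        R ^ (j + 1) * S * (R * C) ^ (p + j) * ((j + 1) * m)) := by
    have : ((j + 1) * R ^ j * Q * S + R ^ (j + 1) * ((j + 1) * C ^ (2 * j + 1) * μ)) * D * R ^ j =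
      (j + 1) * R ^ (2 * j) * S * (Q * D) +
        R ^ (2 * j + 1) * ((j + 1) * C ^ (2 * j + 1) * μ) * D := by ring
    rw [this, hQ, hN, hD]
    linear_combination ((j + 1) * R ^ (2 * j + 1 + p) * μ *
      (S * C ^ (p + j) * m + R ^ p * C ^ (2 * (p + j) + 1) * F ^ 2)) * hCS
  refine ⟨hA, ?_⟩
  rw [hm] at hB
  linear_combination hB + (R * C) ^ (p + j) * ((p + j + 1) * F + R * C * F') * R ^ j * hA

lemma continuousAt_polarDen {F R : ℝ → ℝ} {k l p : ℕ} {θ : ℝ} (hk : 1 ≤ k)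
    (hR : ContinuousAt R θ) (hF : AnalyticAt ℝ F (R θ * quasiCos k θ)) :
    ContinuousAt (fun θ => polarDen k l p F (R θ) θ) θ := by
  have hk0 : (k : ℝ) ≠ 0 := by positivity
  have h1 := (continuous_quasiCos hk).continuousAt (x := θ)
  have h2 := (continuous_quasiSin hk).continuousAt (x := θ)
  have hz : ContinuousAt (fun θ => R θ * quasiCos k θ) θ := hR.mul h1
  have h3 : ContinuousAt (fun θ => F (R θ * quasiCos k θ)) θ :=
    ContinuousAt.comp (f := fun θ => R θ * quasiCos k θ) hF.continuousAt hz
  have h4 : ContinuousAt (fun θ => deriv F (R θ * quasiCos k θ)) θ :=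
    ContinuousAt.comp (f := fun θ => R θ * quasiCos k θ) hF.deriv.continuousAt hz
  unfold polarDen lienardCoef
  fun_prop (disch := assumption)

/-- The polar solution traces a curve tangent to the field with positive angular speed; changing
time makes it an orbit, and one turn in θ is one return. -/
theorem exists_firstReturn_of_pos {f g : ℝ → ℝ} {k l p : ℕ} (hf : AnalyticAt ℝ f 0)
    (hg : AnalyticAt ℝ g 0) (hf0 : 0 < f 0) (hk : 1 ≤ k) (hp : 1 ≤ p) (hl : l + 1 = p + k) :
    ∃ η : ℝ → ℝ, AnalyticAt ℝ η 0 ∧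
      η 0 = lienardCoef k l (quotF f g) 0 / k * (2 * (1 + (-1) ^ l) * betaInt k l) ∧
      deriv η 0 = deriv (lienardCoef k l (quotF f g)) 0 / k *
        (2 * (1 + (-1) ^ (l + 1)) * betaInt k (l + 1)) + (if p = 1 then η 0 ^ 2 else 0) ∧
      ∀ U ∈ 𝓝 ((0, 0) : ℝ × ℝ), ∀ᶠ ε in 𝓝[>] (0 : ℝ),
        FirstReturn (nilpotentField f g k l) (transversal f g l) U ε (ε + ε ^ (p + 1) * η ε) := by
  set F := quotF f g with hFdef
  have hF : AnalyticAt ℝ F 0 := hg.div hf hf0.ne'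
  obtain ⟨η, hηa, hη0, hη1, hη⟩ := exists_polar_solution (l := l) hF hk hp
  refine ⟨η, hηa, hη0, hη1, fun U hU => ?_⟩
  obtain ⟨ρ, hρ, hρU⟩ := Metric.mem_nhds_iff.1 hU
  have hev : ∀ᶠ z in 𝓝 (0 : ℝ), AnalyticAt ℝ f z ∧ AnalyticAt ℝ F z ∧
      0 < f z ∧ |F z| < |F 0| + 1 :=
    hf.eventually_analyticAt.and (hF.eventually_analyticAt.and
      ((hf.continuousAt.eventually (lt_mem_nhds hf0)).and
        (hF.continuousAt.abs.eventually (gt_mem_nhds (lt_add_one _)))))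
  obtain ⟨δ₀, hδ₀, hball⟩ := Metric.eventually_nhds_iff.1 hev
  set B := |F 0| + 1 with hB
  have hB0 : 0 < B := by positivity
  -- `δ₀` controls f and F; R < 1 gives R^k ≤ R and |z|^(l+1) ≤ R; then |w| ≤ R (1 + B) < ρ keeps
  -- the orbit in U.
  set δ := min δ₀ (min 1 (ρ / (1 + B))) with hδ
  have hδ0 : 0 < δ := by positivity
  filter_upwards [hη δ hδ0, self_mem_nhdsWithin] with ε ⟨R, hR0, hRL, hR⟩ hε
  set z : ℝ → ℝ := fun θ => R θ * quasiCos k θ with hz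
  set β : ℝ → ℝ × ℝ :=
    fun θ => (z θ, R θ ^ k * quasiSin k θ + z θ ^ (l + 1) * F (z θ)) with hβ
  -- The angular velocity dθ/dt along the field.
  set ω : ℝ → ℝ := fun θ =>
    f (z θ) * (R θ ^ (k - 1) * polarDen k l p F (R θ) θ) / quasiSpeed k θ with hω
  have hzR : ∀ θ ∈ Icc 0 (2 * π), |z θ| ≤ R θ := fun θ hθ => by
    rw [hz, abs_mul, abs_of_pos (hR θ hθ).1]
    exact mul_le_of_le_one_right (hR θ hθ).1.le (abs_quasiCos_le_one hk θ)
  have hloc : ∀ θ ∈ Icc 0 (2 * π), AnalyticAt ℝ f (z θ) ∧ AnalyticAt ℝ F (z θ) ∧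
      0 < f (z θ) ∧ |F (z θ)| < B := fun θ hθ => by
    refine hball ?_
    rw [Real.dist_eq, sub_zero]
    exact ((hzR θ hθ).trans_lt (hR θ hθ).2.1).trans_le (min_le_left _ _)
  have hgF : ∀ θ ∈ Icc 0 (2 * π), g (z θ) = f (z θ) * F (z θ) := fun θ hθ => by
    rw [hFdef, quotF, mul_div_cancel₀ _ (hloc θ hθ).2.2.1.ne']
  have hωpos : ∀ θ ∈ Icc 0 (2 * π), 0 < ω θ := fun θ hθ => by
    have h1 := (hR θ hθ).1
    have h2 := (hR θ hθ).2.2.1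
    have h3 := quasiSpeed_pos hk θ
    have h4 := (hloc θ hθ).2.2.1
    positivity
  have hzd : ∀ θ ∈ Icc 0 (2 * π), HasDerivAt z _ θ := fun θ hθ =>
    (hR θ hθ).2.2.2.mul (hasDerivAt_quasiCos hk θ)
  have hωc : ContinuousOn ω (Icc 0 (2 * π)) := fun θ hθ => by
    refine ContinuousAt.continuousWithinAt ?_
    have h1 : ContinuousAt R θ := (hR θ hθ).2.2.2.continuousAt
    have hzc : ContinuousAt z θ := (hzd θ hθ).continuousAt
    have h2 : ContinuousAt (fun θ => f (z θ)) θ :=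
      ContinuousAt.comp (hloc θ hθ).1.continuousAt hzc
    have h7 := (continuous_quasiSpeed k).continuousAt (x := θ)
    have h8 := continuousAt_polarDen (l := l) (p := p) hk h1 (hloc θ hθ).2.1
    exact (h2.mul ((h1.pow _).mul h8)).div h7 (quasiSpeed_pos hk θ).ne'
  have hβd : ∀ θ ∈ Icc 0 (2 * π),
      HasDerivAt β ((ω θ)⁻¹ • nilpotentField f g k l (β θ)) θ := fun θ hθ => by
    -- Writing k = j + 1 and l = p + j removes truncated subtraction from the exponents.
    obtain ⟨j, rfl⟩ : ∃ j, k = j + 1 := ⟨k - 1, by omega⟩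
    obtain rfl : l = p + j := by omega
    obtain ⟨hRpos, -, hDpos, hRd⟩ := hR θ hθ
    have hd := (hzd θ hθ).prodMk (((hRd.pow (j + 1)).mul (hasDerivAt_quasiSin hk θ)).add
      (((hzd θ hθ).pow (p + j + 1)).mul
        ((hloc θ hθ).2.1.differentiableAt.hasDerivAt.comp θ (hzd θ hθ))))
    refine HasDerivAt.congr_deriv (f := β) hd ?_
    set Q := quasiSpeed (j + 1) θ * R θ ^ (p + 1) * polarNum (j + 1) (p + j) p F (R θ) θ /
      polarDen (j + 1) (p + j) p F (R θ) θ with hQ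
    have hj : ((j + 1 : ℕ) : ℝ) ≠ 0 := by positivity
    obtain ⟨h1, h2⟩ := polar_velocity_aux (j := j) (p := p) (R := R θ) (C := quasiCos (j + 1) θ)
      (S := quasiSin (j + 1) θ) (μ := quasiSpeed (j + 1) θ) (F := F (z θ)) (F' := deriv F (z θ))
      (m := lienardCoef (j + 1) (p + j) F (z θ) / (j + 1 : ℕ))
      (D := polarDen (j + 1) (p + j) p F (R θ) θ) (N := polarNum (j + 1) (p + j) p F (R θ) θ)
      (Q := Q) (quasiCos_pow_add_quasiSin_sq hk θ)
      (by rw [polarNum]; ring) (by rw [polarDen]; ring)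
      (div_mul_cancel₀ _ hDpos.ne')
      (by
        rw [← Nat.cast_add_one, mul_div_cancel₀ _ hj, lienardCoef]
        push_cast
        rfl)
    have hωz := (hωpos θ hθ).ne'
    have hsp := (quasiSpeed_pos hk θ).ne'
    have hω' : ω θ * quasiSpeed (j + 1) θ =
        f (z θ) * (R θ ^ j * polarDen (j + 1) (p + j) p F (R θ) θ) := by
      rw [hω]; exact div_mul_cancel₀ _ hsp
    rw [eq_inv_smul_iff₀ hωz]
    have hexp : 2 * (j + 1) - 1 = 2 * j + 1 := by omega
    simp only [nilpotentField, hβ, hgF θ hθ, hexp, Prod.smul_mk, smul_eq_mul, Pi.pow_apply,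
      Function.comp_apply, Nat.add_sub_cancel]
    ext
    · simp only
      apply mul_right_cancel₀ hsp
      linear_combination (Q * quasiCos (j + 1) θ +
        R θ * (-(quasiSpeed (j + 1) θ * quasiSin (j + 1) θ))) * hω' + f (z θ) * R θ ^ j * h1
    · simp only
      apply mul_right_cancel₀ hsp
      push_cast
      linear_combination (((j + 1) * R θ ^ j * Q * quasiSin (j + 1) θ + R θ ^ (j + 1) *
        ((j + 1) * quasiCos (j + 1) θ ^ (2 * j + 1) * quasiSpeed (j + 1) θ) +
        (((p + j + 1) * (R θ * quasiCos (j + 1) θ) ^ (p + j) * (Q * quasiCos (j + 1) θ +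
          R θ * (-(quasiSpeed (j + 1) θ * quasiSin (j + 1) θ)))) * F (z θ) +
        (R θ * quasiCos (j + 1) θ) ^ (p + j + 1) * (deriv F (z θ) * (Q * quasiCos (j + 1) θ +
          R θ * (-(quasiSpeed (j + 1) θ * quasiSin (j + 1) θ))))))) * hω' + f (z θ) * h2
  obtain ⟨T, σ, hT, hσ0, hσT, hσm, hcurve⟩ :=
    exists_reparametrization two_pi_pos hωc hωpos hβd
  have hmem : ∀ t ∈ Icc 0 T, σ t ∈ Icc 0 (2 * π) := fun t ht =>
    ⟨hσ0 ▸ hσm.monotone ht.1, hσT ▸ hσm.monotone ht.2⟩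
  have hcut : ∀ θ ∈ Icc 0 (2 * π), β θ ∈ transversal f g l →
      0 < quasiCos k θ ∧ quasiSin k θ = 0 := fun θ hθ h => by
    have hRpos := (hR θ hθ).1
    refine ⟨(mul_pos_iff_of_pos_left hRpos).1 h.1, ?_⟩
    have h1 : f (z θ) * (R θ ^ k * quasiSin k θ + z θ ^ (l + 1) * F (z θ)) =
      z θ ^ (l + 1) * g (z θ) := h.2
    rw [hgF θ hθ] at h1
    have h2 : f (z θ) * R θ ^ k * quasiSin k θ = 0 := by linear_combination h1
    exact (mul_eq_zero.1 h2).resolve_left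
      (mul_pos (hloc θ hθ).2.2.1 (pow_pos hRpos _)).ne'
  have hend : ∀ θ ∈ Icc 0 (2 * π), quasiCos k θ = 1 → quasiSin k θ = 0 →
      β θ ∈ transversal f g l ∧ (β θ).1 = R θ := fun θ hθ hC hS => by
    have h1 : z θ = R θ := by rw [hz]; simp only [hC, mul_one]
    refine ⟨⟨by rw [hβ]; simp only [h1]; exact (hR θ hθ).1, ?_⟩, h1⟩
    change f (z θ) * (R θ ^ k * quasiSin k θ + z θ ^ (l + 1) * F (z θ)) =
      z θ ^ (l + 1) * g (z θ)
    rw [hgF θ hθ, hS]; ring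
  have h0 := hend 0 (left_mem_Icc.2 two_pi_pos.le) (quasiCos_zero k) (quasiSin_zero k)
  have h1 := hend (2 * π) (right_mem_Icc.2 two_pi_pos.le) (quasiCos_two_pi k) (quasiSin_two_pi k)
  refine ⟨β ∘ σ, T, hT, hcurve, fun t ht => hρU ?_, ?_, ?_, ?_, ?_, fun t ht hS => ?_⟩
  · have hθ := hmem t ht
    have hRpos := (hR _ hθ).1
    have hRδ := (hR _ hθ).2.1
    have hR1 : R (σ t) ≤ 1 := (hRδ.trans_le ((min_le_right _ _).trans (min_le_left _ _))).le
    have hRρ : R (σ t) * (1 + B) < ρ := by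
      rw [← lt_div_iff₀ (by positivity)]
      exact hRδ.trans_le ((min_le_right _ _).trans (min_le_right _ _))
    have hz1 := hzR _ hθ
    rw [mem_ball_iff_norm, Prod.norm_def, max_lt_iff]
    constructor
    · simp only [Function.comp, hβ, sub_zero, Prod.fst_sub, Real.norm_eq_abs]
      nlinarith
    · simp only [Function.comp, hβ, sub_zero, Prod.snd_sub, Real.norm_eq_abs]
      have e1 : |R (σ t) ^ k * quasiSin k (σ t)| ≤ R (σ t) := by
        rw [abs_mul, abs_of_pos (pow_pos hRpos _)]
        exact (mul_le_of_le_one_right (pow_pos hRpos _).le (abs_quasiSin_le_one hk _)).trans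
          (pow_le_of_le_one hRpos.le hR1 (by omega))
      have e2 : |z (σ t) ^ (l + 1) * F (z (σ t))| ≤ R (σ t) * B := by
        rw [abs_mul, abs_pow]
        refine mul_le_mul ?_ (hloc _ hθ).2.2.2.le (abs_nonneg _) hRpos.le
        exact (pow_le_of_le_one (abs_nonneg _) (hz1.trans hR1) (by omega)).trans hz1
      calc _ ≤ _ := abs_add_le _ _
        _ ≤ R (σ t) + R (σ t) * B := add_le_add e1 e2
        _ = R (σ t) * (1 + B) := by ring
        _ < ρ := hRρ
  · simp only [Function.comp, hσ0]; exact h0.1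
  · simp only [Function.comp, hσ0]; exact h0.2.trans hR0
  · simp only [Function.comp, hσT]; exact h1.1
  · simp only [Function.comp, hσT]; exact h1.2.trans hRL
  · have hθ : σ t ∈ Ioo 0 (2 * π) := ⟨hσ0 ▸ hσm ht.1, hσT ▸ hσm ht.2⟩
    obtain ⟨h2, h3⟩ := hcut _ (hmem t (Ioo_subset_Icc_self ht)) hS
    exact absurd h2 (quasiCos_neg_of_quasiSin_eq_zero hθ h3).not_gt

lemma quotF_neg_neg (f g : ℝ → ℝ) : quotF (-f) (-g) = quotF f g := by
  funext z; simp [quotF]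

lemma quotF_neg_right (f g : ℝ → ℝ) : quotF f (-g) = -quotF f g := by
  funext z; simp [quotF, neg_div]

lemma transversal_neg_neg (f g : ℝ → ℝ) (l : ℕ) : transversal (-f) (-g) l = transversal f g l := by
  ext q; simp [transversal]

lemma nilpotentField_neg_neg (f g : ℝ → ℝ) (k l : ℕ) (q : ℝ × ℝ) :
    nilpotentField (-f) (-g) k l q = -nilpotentField f g k l q := by
  ext <;> simp [nilpotentField] <;> ring

lemma orientedField_of_pos {f : ℝ → ℝ} (g : ℝ → ℝ) (k l : ℕ) (h : 0 < f 0) :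
    orientedField f g k l = nilpotentField f g k l := by
  funext q; simp [orientedField, sign_pos h]

lemma orientedField_of_neg {f : ℝ → ℝ} (g : ℝ → ℝ) (k l : ℕ) (h : f 0 < 0) :
    orientedField f g k l = fun q => -nilpotentField f g k l q := by
  funext q; simp [orientedField, sign_neg h]

/-- For f(0) < 0, changing the signs of f and g reverses time but preserves F and the transversal.
-/
theorem exists_firstReturn {f g : ℝ → ℝ} {k l p : ℕ} (hf : AnalyticAt ℝ f 0)
    (hg : AnalyticAt ℝ g 0) (hf0 : f 0 ≠ 0) (hk : 1 ≤ k) (hp : 1 ≤ p) (hl : l + 1 = p + k) :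
    ∃ η : ℝ → ℝ, AnalyticAt ℝ η 0 ∧
      η 0 = lienardCoef k l (quotF f g) 0 / k * (2 * (1 + (-1) ^ l) * betaInt k l) ∧
      deriv η 0 = deriv (lienardCoef k l (quotF f g)) 0 / k *
        (2 * (1 + (-1) ^ (l + 1)) * betaInt k (l + 1)) + (if p = 1 then η 0 ^ 2 else 0) ∧
      ∀ U ∈ 𝓝 ((0, 0) : ℝ × ℝ), ∀ᶠ ε in 𝓝[>] (0 : ℝ),
        FirstReturn (orientedField f g k l) (transversal f g l) U ε (ε + ε ^ (p + 1) * η ε) := by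
  rcases hf0.lt_or_gt with h | h
  · have := exists_firstReturn_of_pos hf.neg hg.neg (by simpa using h) hk hp hl
    rw [quotF_neg_neg, transversal_neg_neg] at this
    rw [orientedField_of_neg g k l h]
    simpa only [funext (nilpotentField_neg_neg f g k l)] using this
  · rw [orientedField_of_pos g k l h]
    exact exists_firstReturn_of_pos hf hg h hk hp hl

/-! ### Uniqueness of orbits and necessary conditions for a center -/

/-- Uniqueness of integral curves as long as one of them stays in an open set on which the field is
Lipschitz. -/
theorem eqOn_of_isIntegralCurveOn {E : Type*} [NormedAddCommGroup E] [NormedSpace ℝ E] {v : E → E}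
    {K : NNReal} {O : Set E} (hO : IsOpen O) (hv : LipschitzOnWith K v O) {γ γ' : ℝ → E} {T : ℝ}
    (hγ : IsIntegralCurveOn γ (fun _ => v) (Icc 0 T))
    (hγ' : IsIntegralCurveOn γ' (fun _ => v) (Icc 0 T)) (h0 : γ 0 = γ' 0)
    (hmem : ∀ t ∈ Icc 0 T, γ' t ∈ O) : EqOn γ γ' (Icc 0 T) := by
  have hc := hγ.continuousOn
  have hc' := hγ'.continuousOn
  have hclosed : IsClosed ({t | γ t = γ' t} ∩ Icc 0 T) := by
    have := (hc.prodMk hc').preimage_isClosed_of_isClosed isClosed_Icc isClosed_diagonal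
    rwa [inter_comm] at this
  refine hclosed.Icc_subset_of_forall_mem_nhdsWithin h0 fun a ha => ?_
  obtain ⟨haeq, haI⟩ := ha
  have haI' := Ico_subset_Icc_self haI
  -- Only γ' is assumed to stay in O; γ does so near a by continuity, as the two agree at a.
  have hev : ∀ᶠ t in 𝓝[Icc 0 T] a, γ t ∈ O ∧ γ' t ∈ O :=
    ((hc a haI').eventually_mem (hO.mem_nhds (by rw [haeq]; exact hmem a haI'))).and
      ((hc' a haI').eventually_mem (hO.mem_nhds (hmem a haI')))
  obtain ⟨r, hr, hball⟩ := Metric.mem_nhdsWithin_iff.1 hev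
  set b := min (a + r / 2) T with hb
  have hab : a < b := lt_min (by linarith) haI.2
  have hsub : Icc a b ⊆ Metric.ball a r ∩ Icc 0 T := fun t ht => by
    refine ⟨?_, haI.1.trans ht.1, ht.2.trans (min_le_right _ _)⟩
    rw [Metric.mem_ball, Real.dist_eq, abs_of_nonneg (by linarith [ht.1])]
    linarith [ht.2.trans (min_le_left _ _)]
  have hd : ∀ {c : ℝ → E}, IsIntegralCurveOn c (fun _ => v) (Icc 0 T) → ∀ t ∈ Ico a b,
      HasDerivWithinAt c (v (c t)) (Ici t) t := fun h t ht => by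
    have h1 := (hsub (Ico_subset_Icc_self ht)).2
    refine (h t h1).mono_of_mem_nhdsWithin ?_
    exact mem_of_superset (Icc_mem_nhdsGE (ht.2.trans_le (min_le_right _ _)))
      (Icc_subset_Icc_left h1.1)
  have heq : EqOn γ γ' (Icc a b) :=
    ODE_solution_unique_of_mem_Icc_right (v := fun _ => v) (s := fun _ => O) (fun _ _ => hv)
      (hc.mono fun t ht => (hsub ht).2) (hd hγ)
      (fun t ht => (hball (hsub (Ico_subset_Icc_self ht))).1)
      (hc'.mono fun t ht => (hsub ht).2) (hd hγ')
      (fun t ht => (hball (hsub (Ico_subset_Icc_self ht))).2) haeq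
  exact mem_of_superset (Icc_mem_nhdsGT hab) heq

lemma IsIntegralCurve.shift {E : Type*} [NormedAddCommGroup E] [NormedSpace ℝ E] {v : E → E}
    {γ : ℝ → E} (h : IsIntegralCurve γ fun _ => v) (a : ℝ) (s : Set ℝ) :
    IsIntegralCurveOn (fun t => γ (a + t)) (fun _ => v) s := fun t _ =>
  ((h (a + t)).comp_const_add a t).hasDerivWithinAt

/-- A nonzero periodic solution of a field vanishing at `0` is bounded away from `0`. -/
theorem exists_pos_le_norm_of_periodic {E : Type*} [NormedAddCommGroup E] [NormedSpace ℝ E]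
    {v : E → E} {K : NNReal} {O : Set E} (hO : IsOpen O) (hv : LipschitzOnWith K v O)
    (h0O : (0 : E) ∈ O) (hv0 : v 0 = 0) {γ : ℝ → E} {T : ℝ} (hT : 0 < T)
    (hγ : IsIntegralCurve γ fun _ => v) (hper : Function.Periodic γ T) (hne : γ 0 ≠ 0) :
    ∃ b > 0, ∀ t, b ≤ ‖γ t‖ := by
  -- Forward uniqueness suffices: a zero at time a persists until some nT ≥ a, and γ(nT) = γ(0) ≠ 0.
  have hne' : ∀ t, γ t ≠ 0 := fun a ha => by
    obtain ⟨n, hn⟩ := exists_nat_gt (a / T)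
    have hn' : 0 ≤ n * T - a := by rw [div_lt_iff₀ hT] at hn; linarith
    have := eqOn_of_isIntegralCurveOn (γ' := fun _ => (0 : E)) (T := n * T - a) hO hv
      (hγ.shift a _) (fun t _ => by simpa [hv0] using hasDerivWithinAt_const t _ (0 : E))
      (by simpa using ha) (fun _ _ => h0O) (right_mem_Icc.2 hn')
    simp only [add_sub_cancel] at this
    refine hne ?_
    rw [← this, ← hper.nat_mul n 0, zero_add]
  obtain ⟨t₀, -, ht₀⟩ := isCompact_Icc.exists_isMinOn (nonempty_Icc.2 hT.le)
    hγ.continuous.norm.continuousOn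
  refine ⟨‖γ t₀‖, norm_pos_iff.2 (hne' t₀), fun t => ?_⟩
  obtain ⟨s, hs, hst⟩ := hper.exists_mem_Ico₀ hT t
  rw [hst]
  exact ht₀ (Ico_subset_Icc_self hs)

/-- An equilibrium with a contracting return map on a transversal is not a center. -/
theorem not_isCenterAtOrigin_of_contracting {v : ℝ × ℝ → ℝ × ℝ} (hv : ContDiffAt ℝ 1 v (0, 0))
    {S : Set (ℝ × ℝ)} {s Z : ℝ → ℝ} (hs : ContinuousAt s 0) (hs0 : s 0 = 0)
    (hS : ∀ᶠ q in 𝓝 ((0, 0) : ℝ × ℝ), q ∈ S → q.2 = s q.1) (hSpos : ∀ q ∈ S, 0 < q.1)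
    (hZc : ∀ᶠ ε in 𝓝[>] (0 : ℝ), ContinuousAt Z ε)
    (hret : ∀ U ∈ 𝓝 ((0, 0) : ℝ × ℝ), ∀ᶠ ε in 𝓝[>] (0 : ℝ), FirstReturn v S U ε (Z ε))
    (hlt : ∀ᶠ ε in 𝓝[>] (0 : ℝ), Z ε < ε) : ¬ IsCenterAtOrigin v := by
  rintro ⟨hv0, W, hW, hper⟩
  obtain ⟨K, O', hO', hlip'⟩ := hv.exists_lipschitzOnWith
  set O := interior O' with hOdef
  have hO : IsOpen O := isOpen_interior
  have h0O : ((0, 0) : ℝ × ℝ) ∈ O := mem_interior_iff_mem_nhds.2 hO'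
  have hlip : LipschitzOnWith K v O := hlip'.mono interior_subset
  -- W supplies the periodic solution and O uniqueness; in the last set a point of S is determined
  -- by its first coordinate, so successive returns lie on the same periodic orbit.
  set U := W ∩ O ∩ {q | q ∈ S → q.2 = s q.1} with hU
  have hUn : U ∈ 𝓝 ((0, 0) : ℝ × ℝ) := inter_mem (inter_mem hW (hO.mem_nhds h0O)) hS
  obtain ⟨δ, hδ, hev⟩ := mem_nhdsGT_iff_exists_Ioo_subset.1 (hZc.and ((hret U hUn).and hlt))
  have hδ0 : (0 : ℝ) < δ := hδ
  have hε : δ / 2 ∈ Ioo 0 δ := ⟨by positivity, by linarith⟩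
  obtain ⟨-, ⟨γ₀, T₀, hT₀, -, hU₀, hS₀, h1₀, -⟩, -⟩ := hev hε
  have hq : γ₀ 0 ≠ (0, 0) := fun h => by
    rw [h] at h1₀; exact hε.1.ne h1₀
  have hqU := hU₀ 0 (left_mem_Icc.2 hT₀.le)
  obtain ⟨γ, T, hT, hγ, hγ0, hγper, -⟩ := hper _ hqU.1.1 hq
  obtain ⟨b, hb, hbγ⟩ := exists_pos_le_norm_of_periodic hO hlip h0O hv0 hT hγ hγper
    (by rw [hγ0]; exact hq)
  have hiter : ∀ n : ℕ, Z^[n] (δ / 2) ∈ Ioo 0 δ ∧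
      ∃ t, γ t ∈ S ∧ γ t ∈ U ∧ (γ t).1 = Z^[n] (δ / 2) := fun n => by
    induction n with
    | zero => exact ⟨hε, 0, by rwa [hγ0], by rwa [hγ0], by rwa [hγ0]⟩
    | succ n ih =>
      obtain ⟨hz, t, htS, htU, ht1⟩ := ih
      obtain ⟨-, ⟨γ', T', hT', hγ', hU', hS', h1', hST', h1T', -⟩, hlt'⟩ := hev hz
      have hU0 := hU' 0 (left_mem_Icc.2 hT'.le)
      have hinit : γ (t + 0) = γ' 0 := by
        rw [add_zero]
        refine Prod.ext (ht1.trans h1'.symm) ?_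
        rw [htU.2 htS, hU0.2 hS', ht1, h1']
      have heq := eqOn_of_isIntegralCurveOn hO hlip (hγ.shift t _) hγ' hinit
        (fun r hr => (hU' r hr).1.2) (right_mem_Icc.2 hT'.le)
      simp only at heq
      rw [Function.iterate_succ_apply']
      refine ⟨⟨h1T' ▸ hSpos _ hST', hlt'.trans hz.2⟩, t + T', ?_⟩
      rw [heq]
      exact ⟨hST', hU' _ (right_mem_Icc.2 hT'.le), h1T'⟩
  have hanti : Antitone fun n : ℕ => Z^[n] (δ / 2) := antitone_nat_of_succ_le fun n => by
    rw [Function.iterate_succ_apply']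
    exact (hev (hiter n).1).2.2.le
  have hbdd : BddBelow (range fun n : ℕ => Z^[n] (δ / 2)) :=
    ⟨0, by rintro _ ⟨n, rfl⟩; exact (hiter n).1.1.le⟩
  have hlim := tendsto_atTop_ciInf hanti hbdd
  set a := ⨅ n : ℕ, Z^[n] (δ / 2) with ha
  have ha0 : 0 ≤ a := le_ciInf fun n => (hiter n).1.1.le
  have haδ : a < δ := (ciInf_le hbdd 0).trans_lt (hiter 0).1.2
  -- A positive limit of the iterates would be a fixed point of Z by continuity, against Z a < a.
  have haz : a = 0 := by
    by_contra hne
    have hmem : a ∈ Ioo 0 δ := ⟨lt_of_le_of_ne ha0 (Ne.symm hne), haδ⟩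
    obtain ⟨hc, -, hlt'⟩ := hev hmem
    have h1 := hc.tendsto.comp hlim
    have h2 : Tendsto (fun n : ℕ => Z^[n + 1] (δ / 2)) atTop (𝓝 a) :=
      hlim.comp (tendsto_add_atTop_nat 1)
    simp only [Function.iterate_succ_apply'] at h2
    exact hlt'.ne (tendsto_nhds_unique h1 h2)
  rw [haz] at hlim
  choose t htS htU ht1 using fun n => (hiter n).2
  have hγt : Tendsto (fun n => γ (t n)) atTop (𝓝 (0, 0)) := by
    have h2 : Tendsto (fun n : ℕ => s (Z^[n] (δ / 2))) atTop (𝓝 0) := by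
      have := hs.tendsto.comp hlim
      rwa [hs0] at this
    refine (hlim.prodMk_nhds h2).congr fun n => ?_
    refine Prod.ext (ht1 n).symm ?_
    rw [(htU n).2 (htS n), ht1 n]
  have hnorm := hγt.norm
  rw [show ((0, 0) : ℝ × ℝ) = 0 from rfl, norm_zero] at hnorm
  exact absurd (ge_of_tendsto hnorm (Eventually.of_forall fun n => hbγ (t n))) hb.not_ge

lemma IsCenterAtOrigin.neg {v : ℝ × ℝ → ℝ × ℝ} (h : IsCenterAtOrigin v) :
    IsCenterAtOrigin fun q => -v q := by
  obtain ⟨h0, U, hU, hper⟩ := h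
  refine ⟨by simp [h0], U, hU, fun q hq hne => ?_⟩
  obtain ⟨γ, T, hT, hγ, hγ0, hγT, t, ht⟩ := hper q hq hne
  refine ⟨fun s => γ (-s), T, hT, fun s => ?_, by simpa using hγ0, fun s => ?_, -t, by simpa⟩
  · exact ((hγ (-s)).scomp s (hasDerivAt_neg s)).congr_deriv (by simp)
  · simpa only [neg_add, sub_eq_add_neg] using hγT.sub_eq (-s)

lemma IsCenterAtOrigin.reflect {v : ℝ × ℝ → ℝ × ℝ} (h : IsCenterAtOrigin v) :
    IsCenterAtOrigin fun q => ((v (q.1, -q.2)).1, -(v (q.1, -q.2)).2) := by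
  obtain ⟨h0, U, hU, hper⟩ := h
  have hρ : Continuous fun q : ℝ × ℝ => (q.1, -q.2) := by fun_prop
  refine ⟨by simp [h0], (fun q : ℝ × ℝ => (q.1, -q.2)) ⁻¹' U,
    hρ.continuousAt.preimage_mem_nhds (by simpa using hU), fun q hq hne => ?_⟩
  obtain ⟨γ, T, hT, hγ, hγ0, hγT, t, ht⟩ := hper (q.1, -q.2) hq fun h => hne (by
    rw [Prod.mk.injEq, neg_eq_zero] at h; exact Prod.ext h.1 h.2)
  refine ⟨fun s => ((γ s).1, -(γ s).2), T, hT, fun s => ?_, by simp [hγ0], fun s => ?_, t, ?_⟩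
  · have h1 : HasDerivAt (fun s => (γ s).1) (v (γ s)).1 s :=
      (hasFDerivAt_fst (𝕜 := ℝ) (p := γ s)).comp_hasDerivAt s (hγ s)
    have h2 : HasDerivAt (fun s => (γ s).2) (v (γ s)).2 s :=
      (hasFDerivAt_snd (𝕜 := ℝ) (p := γ s)).comp_hasDerivAt s (hγ s)
    exact (h1.prodMk h2.neg).congr_deriv (by simp)
  · simp only [hγT s]
  · intro heq
    refine ht ?_
    rw [← heq]
    simp

/-- This symmetry preserves centers and changes the sign of F, so only the contracting sign needs to
be excluded. -/
lemma nilpotentField_neg_right (f g : ℝ → ℝ) (k l : ℕ) :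
    nilpotentField f (-g) k l = fun q =>
      -((nilpotentField f g k l (q.1, -q.2)).1, -(nilpotentField f g k l (q.1, -q.2)).2) := by
  funext q
  ext
  · simp [nilpotentField]
    ring
  · simp [nilpotentField]

lemma betaInt_pos {k : ℕ} (hk : 1 ≤ k) (n : ℕ) : 0 < betaInt k n := integral_pow_mul_sqrt_pos hk n

lemma analyticAt_orientedField {f g : ℝ → ℝ} (hf : AnalyticAt ℝ f 0) (hg : AnalyticAt ℝ g 0)
    (k l : ℕ) : AnalyticAt ℝ (orientedField f g k l) (0, 0) := by
  have h1 : AnalyticAt ℝ (fun q : ℝ × ℝ => q.1) (0, 0) := analyticAt_fst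
  have h2 : AnalyticAt ℝ (fun q : ℝ × ℝ => q.2) (0, 0) := analyticAt_snd
  have h3 : AnalyticAt ℝ (fun q : ℝ × ℝ => f q.1) (0, 0) := AnalyticAt.fun_comp hf h1
  have h4 : AnalyticAt ℝ (fun q : ℝ × ℝ => g q.1) (0, 0) := AnalyticAt.fun_comp hg h1
  unfold orientedField nilpotentField
  fun_prop

/-- In both cases η is negative for small ε > 0. For even l its sign is that of η(0); for odd l,
η(0) vanishes by parity and η'(0) decides. -/
theorem not_isCenterAtOrigin_of_neg {f g : ℝ → ℝ} {k l p : ℕ} (hf : AnalyticAt ℝ f 0)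
    (hg : AnalyticAt ℝ g 0) (hf0 : f 0 ≠ 0) (hk : 1 ≤ k) (hp : 1 ≤ p) (hl : l + 1 = p + k)
    (h : (Even l ∧ quotF f g 0 < 0) ∨ (Odd l ∧ deriv (quotF f g) 0 < 0)) :
    ¬ IsCenterAtOrigin (nilpotentField f g k l) := by
  intro hcenter
  have hcenter' : IsCenterAtOrigin (orientedField f g k l) := by
    rcases hf0.lt_or_gt with h | h
    · rw [orientedField_of_neg g k l h]; exact hcenter.neg
    · rwa [orientedField_of_pos g k l h]
  obtain ⟨η, hηa, hη0, hη1, hret⟩ := exists_firstReturn hf hg hf0 hk hp hl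
  have hF : AnalyticAt ℝ (quotF f g) 0 := hg.div hf hf0
  have hk0 : (0 : ℝ) < k := by exact_mod_cast hk
  have hneg : ∀ᶠ ε in 𝓝[>] (0 : ℝ), η ε < 0 := by
    rcases h with ⟨hev, hF0⟩ | ⟨hodd, hF1⟩
    · have : η 0 < 0 := by
        rw [hη0, lienardCoef_zero, hev.neg_one_pow]
        have h1 : ((k : ℝ) + l + 1) * quotF f g 0 / k < 0 :=
          div_neg_of_neg_of_pos (mul_neg_of_pos_of_neg (by positivity) hF0) hk0
        have h2 := betaInt_pos hk l
        exact mul_neg_of_neg_of_pos h1 (by positivity)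
      exact nhdsWithin_le_nhds (hηa.continuousAt.eventually (gt_mem_nhds this))
    · have h0 : η 0 = 0 := by rw [hη0, hodd.neg_one_pow]; ring
      have hd : deriv η 0 < 0 := by
        rw [hη1, h0, deriv_lienardCoef hF, hodd.add_one.neg_one_pow]
        have h1 : ((k : ℝ) + l + 2) * deriv (quotF f g) 0 / k < 0 :=
          div_neg_of_neg_of_pos (mul_neg_of_pos_of_neg (by positivity) hF1) hk0
        have h2 := betaInt_pos hk (l + 1)
        have h3 := mul_neg_of_neg_of_pos h1
          (by positivity : 0 < 2 * (1 + 1) * betaInt k (l + 1))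
        simpa using h3
      have hslope := (hasDerivAt_iff_tendsto_slope.1 hηa.differentiableAt.hasDerivAt).mono_left
        (nhdsWithin_mono (0 : ℝ) (fun x (hx : 0 < x) => hx.ne') : 𝓝[>] (0 : ℝ) ≤ 𝓝[≠] 0)
      filter_upwards [hslope.eventually (gt_mem_nhds hd), self_mem_nhdsWithin] with ε h1 hε
      rw [slope_def_field, h0, sub_zero, sub_zero] at h1
      exact (div_neg_iff.1 h1).resolve_left (fun h2 => (not_lt.2 (le_of_lt hε)) h2.2) |>.1
  refine not_isCenterAtOrigin_of_contracting (s := fun z => z ^ (l + 1) * quotF f g z)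
    (Z := fun ε => ε + ε ^ (p + 1) * η ε) (analyticAt_orientedField hf hg k l).contDiffAt
    ((continuousAt_id.pow _).mul hF.continuousAt) (by simp) ?_ (fun q hq => hq.1) ?_ hret ?_
    hcenter'
  · have : ∀ᶠ q in 𝓝 ((0, 0) : ℝ × ℝ), f q.1 ≠ 0 :=
      (ContinuousAt.comp (f := fun q : ℝ × ℝ => q.1) (x := ((0, 0) : ℝ × ℝ)) hf.continuousAt
        continuousAt_fst).eventually_ne hf0
    filter_upwards [this] with q hq hqS
    rw [quotF, ← mul_div_assoc, ← hqS.2, mul_div_cancel_left₀ _ hq]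
  · have : ∀ᶠ ε in 𝓝 (0 : ℝ), AnalyticAt ℝ η ε := hηa.eventually_analyticAt
    filter_upwards [nhdsWithin_le_nhds this] with ε hε
    have := hε.continuousAt
    fun_prop
  · filter_upwards [hneg, self_mem_nhdsWithin] with ε h1 hε
    have : ε ^ (p + 1) * η ε < 0 := mul_neg_of_pos_of_neg (pow_pos hε _) h1
    linarith

theorem center_conditions {f g : ℝ → ℝ} {k l p : ℕ} (hf : AnalyticAt ℝ f 0)
    (hg : AnalyticAt ℝ g 0) (hf0 : f 0 ≠ 0) (hk : 1 ≤ k) (hp : 1 ≤ p) (hl : l + 1 = p + k)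
    (hcenter : IsCenterAtOrigin (nilpotentField f g k l)) :
    (Odd l → deriv (quotF f g) 0 = 0) ∧ (Even l → quotF f g 0 = 0) := by
  have hcenter' : IsCenterAtOrigin (nilpotentField f (-g) k l) := by
    rw [nilpotentField_neg_right]; exact hcenter.reflect.neg
  have h1 := fun h => not_isCenterAtOrigin_of_neg hf hg hf0 hk hp hl h hcenter
  have h2 := fun h => not_isCenterAtOrigin_of_neg hf hg.neg hf0 hk hp hl h hcenter'
  rw [quotF_neg_right] at h2
  constructor
  · intro hodd
    by_contra hne
    rcases lt_or_gt_of_ne hne with h | h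
    · exact h1 (Or.inr ⟨hodd, h⟩)
    · refine h2 (Or.inr ⟨hodd, ?_⟩)
      rw [deriv.neg]; linarith
  · intro heven
    by_contra hne
    rcases lt_or_gt_of_ne hne with h | h
    · exact h1 (Or.inl ⟨heven, h⟩)
    · refine h2 (Or.inl ⟨heven, ?_⟩)
      rw [Pi.neg_apply]; linarith

/-! ### Taylor coefficients of the return map and the theorem -/

/-- The power series of `ε + ε^(p+1) η(ε)`. -/
theorem hasFPowerSeriesAt_id_add_pow_mul {η : ℝ → ℝ} {P : FormalMultilinearSeries ℝ ℝ ℝ}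
    (h : HasFPowerSeriesAt η P 0) (p : ℕ) :
    HasFPowerSeriesAt (fun ε => ε + ε ^ (p + 1) * η ε) (FormalMultilinearSeries.ofScalars ℝ
      fun n => (if n = 1 then 1 else 0) + if p + 1 ≤ n then P.coeff (n - (p + 1)) else 0) 0 := by
  rw [hasFPowerSeriesAt_iff] at h ⊢
  filter_upwards [h] with z hz
  simp only [zero_add, FormalMultilinearSeries.coeff_ofScalars, smul_add] at hz ⊢
  refine HasSum.add ?_ ?_
  · have := hasSum_ite_eq (1 : ℕ) z
    refine this.congr_fun fun n => ?_
    split_ifs with h1 <;> simp [h1]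
  · have h1 := (hz.mul_left (z ^ (p + 1)))
    have h2 := (hasSum_nat_add_iff (f := fun n => z ^ n • if p + 1 ≤ n then
      P.coeff (n - (p + 1)) else 0) (p + 1)).1 (h1.congr_fun fun n => by simp; ring)
    rw [Finset.sum_eq_zero, add_zero] at h2
    · exact h2
    · intro n hn
      rw [if_neg (by simpa using hn), smul_zero]

lemma PhiInt_one (p k : ℕ) : PhiInt p k 1 = betaInt k (p + k - 1) := by
  simp [PhiInt, betaInt]

end

theorem mainTheorem4 (f g : ℝ → ℝ) (k l p : ℕ)
    (hf : AnalyticAt ℝ f 0) (hg : AnalyticAt ℝ g 0) (hf0 : f 0 ≠ 0)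
    (hk : 1 ≤ k) (hkl : k ≤ l + 1) (hne : k ≠ l + 1) (hp : (p : ℤ) = l - k + 1) :
    (∃ (Z : ℝ → ℝ) (c : ℕ → ℝ),
      HasFPowerSeriesAt Z (FormalMultilinearSeries.ofScalars ℝ c) 0 ∧
      (∀ U ∈ 𝓝 ((0, 0) : ℝ × ℝ), ∀ᶠ ε in 𝓝[>] (0 : ℝ),
        FirstReturn (orientedField f g k l) (transversal f g l) U ε (Z ε)) ∧
      c 0 = 0 ∧ c 1 = 1 ∧ (∀ n, 2 ≤ n → n ≤ p → c n = 0) ∧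
      c (p + 1) =
        2 * (coefB0 p k (quotF f g) * PhiInt p k 1 / (2 * k)) * (1 + thetaSign p k) ∧
      (2 ≤ p → c (p + 2) =
        2 * (coefB1 p k (quotF f g) * PhiInt (p + 1) k 1 / (2 * k)) * (1 - thetaSign p k)) ∧
      (p = 1 → c (p + 2) =
        2 * (((1 - thetaSign 1 k) * coefB1 1 k (quotF f g) * PhiInt 2 k 1
              + (1 + thetaSign 1 k) / k * coefB0 1 k (quotF f g) ^ 2 * PhiInt 1 k 1 ^ 2) / (2 * k)
            + (coefB0 1 k (quotF f g) * PhiInt 1 k 1 / (2 * k) * (1 + thetaSign 1 k)) ^ 2))) ∧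
    (IsCenterAtOrigin (nilpotentField f g k l) →
      (Odd (p + k - 1) → deriv (quotF f g) 0 = 0) ∧
      (Even (p + k - 1) → quotF f g 0 = 0)) := by
  have hp1 : 1 ≤ p := by omega
  have hl : l + 1 = p + k := by omega
  have hl' : p + k - 1 = l := by omega
  have hk0 : (k : ℝ) ≠ 0 := by positivity
  have hF : AnalyticAt ℝ (quotF f g) 0 := hg.div hf hf0
  refine ⟨?_, fun hcenter => hl' ▸ center_conditions hf hg hf0 hk hp1 hl hcenter⟩
  obtain ⟨η, ⟨P, hP⟩, hη0, hη1, hret⟩ := exists_firstReturn hf hg hf0 hk hp1 hl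
  have hlR : (l : ℝ) + 1 = p + k := by exact_mod_cast hl
  have hP0 : P.coeff 0 = η 0 := by
    rw [← hP.coeff_zero (fun _ => (0 : ℝ))]
    exact congrArg (P 0) (Subsingleton.elim _ _)
  have hP1 : P.coeff 1 = deriv η 0 := hP.deriv.symm
  have hη0' : η 0 =
      2 * (coefB0 p k (quotF f g) * PhiInt p k 1 / (2 * k)) * (1 + thetaSign p k) := by
    rw [hη0, lienardCoef_zero, coefB0, PhiInt_one, thetaSign, hl',
      show (k : ℝ) + l + 1 = p + 2 * k by linarith]
    field_simp
  have hη1' : deriv η 0 =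
      2 * (coefB1 p k (quotF f g) * PhiInt (p + 1) k 1 / (2 * k)) * (1 - thetaSign p k) +
        if p = 1 then η 0 ^ 2 else 0 := by
    rw [hη1, deriv_lienardCoef hF, coefB1, PhiInt_one, thetaSign, hl',
      show p + 1 + k - 1 = l + 1 by omega, show (k : ℝ) + l + 2 = p + 2 * k + 1 by linarith]
    congr 1
    rw [pow_succ]
    field_simp
    ring
  refine ⟨_, _, hasFPowerSeriesAt_id_add_pow_mul hP p, hret, by simp, ?_, ?_, ?_, ?_, ?_⟩
  · simp; omega
  · intro n h2 hn
    rw [if_neg (by omega), if_neg (by omega), add_zero]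
  · rw [if_neg (by omega), if_pos le_rfl, zero_add, Nat.sub_self, hP0, hη0']
  · intro h2
    rw [if_neg (by omega), if_pos (by omega), zero_add, show p + 2 - (p + 1) = 1 by omega, hP1,
      hη1', if_neg (by omega), add_zero]
  · rintro rfl
    rw [if_neg (by omega), if_pos (by omega), zero_add, show 1 + 2 - (1 + 1) = 1 by omega, hP1,
      hη1', if_pos rfl, hη0']
    -- Since (1 + θ)^2 = 2 (1 + θ), half of η(0)^2 can be written linearly in 1 + θ, which is the
    -- asymmetric form of the stated coefficient.
    have hθ : thetaSign 1 k ^ 2 = 1 := by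
      rw [thetaSign, ← pow_mul, (even_two.mul_left _).neg_one_pow]
    generalize thetaSign 1 k = θ at hθ
    field_simp
    linear_combination (coefB0 1 k (quotF f g) ^ 2 * PhiInt 1 k 1 ^ 2) * hθ
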